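/- **Model.** Fix positive reals $\lambda_T,\lambda_A,h,R_B,\alpha_T,\alpha_L,\alpha_N$, positive gains, powers and loss constants $G_M,P_T,P_A,a_n,C_T,C_L,C_N$, and put $\eta_T=G_MP_TC_T$, $\eta_L=a_nP_AC_L$, $\eta_N=a_nP_AC_N$. Let $P_L:[0,\infty)\to[0,1]$ be a measurable function (the line-of-sight probability as a function of horizontal distance, for instance an S-curve such as $P_L(x)=1/(1+a\exp(-b\frac{180}{\pi}\tan^{-1}(\frac hx-a)))$ with $a,b>0$) and $P_N=1-P_L$. The typical user (UE) is at the origin of $\mathbb R^2$. Terrestrial base stations (TBSs) form a homogeneous Poisson point process of density $\lambda_T$ in $\mathbb R^2$. Aerial base stations (ABSs) all have height $h$, and their horizontal locations form a homogeneous Poisson point process of density $\lambda_A$ in $\mathbb R^2$. Given the ABS locations, each ABS at horizontal distance $x$ is independently LoS with probability $P_L(x)$ and NLoS with probability $P_N(x)$. The TBS process is independent of the ABS locations and their link states. Let $R_{T,0}$ be the least horizontal distance from the UE to a TBS, and $R_{L,0}$, $R_{N,0}$ the least (spatial) distance to a LoS, NLoS ABS ($=\infty$ if there is none). The average received powers are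 $\eta_TR_{T,0}^{-\alpha_T}\mathbf 1(R_{T,0}\le R_B)$, $\eta_LR_{L,0}^{-\alpha_L}$, $\eta_NR_{N,0}^{-\alpha_N}$ (with $\infty^{-\alpha}=0$), and the UE associates with the kind of station (TBS, LoS ABS, NLoS ABS) whose average received power is the largest. Let $A_T,A_L,A_N$ be the probabilities of these three events, and put $$Q_T=1-e^{-\pi\lambda_TR_B^2},\qquad \tau_{L|N}(r)=\Big(\frac{\eta_L}{\eta_N}\Big)^{1/\alpha_L}r^{\alpha_N/\alpha_L},$$ $$f_{R_{N,0}}(r)=2\pi\lambda_A\,r\,P_N\big(\sqrt{r^2-h^2}\big)\exp\Big(-2\pi\lambda_A\int_0^{\sqrt{r^2-h^2}}xP_N(x)\,dx\Big)\quad(r\ge h),$$ $$I=\int_h^\infty\exp\Big(-2\pi\lambda_A\int_0^{\sqrt{\tau_{L|N}(r)^2-h^2}}xP_L(x)\,dx\Big)f_{R_{N,0}}(r)\,dr,$$ where $\sqrt{\tau_{L|N}(r)^2-h^2}$ is read as $0$ when $\tau_{L|N}(r)<h$. **Lemma.** The integral $I$ converges absolutely, and the probability that the UE associates with a NLoS ABS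 and no TBS lies in the disc $\mathcal B(0,R_B)$ equals $(1-Q_T)\,I$. Consequently, under the assumption that almost surely the UE does not associate with a NLoS ABS when a TBS lies in $\mathcal B(0,R_B)$, $$A_N=(1-Q_T)\,I .$$ Moreover $A_T=1-A_N-A_L$. -/

import Mathlib

open MeasureTheory ProbabilityTheory
open scoped ENNReal NNReal

noncomputable section

namespace UAVHetNet

/-- The horizontal plane; the typical user (UE) sits at its origin. -/
abbrev Plane : Type := EuclideanSpace ℝ (Fin 2)

/-- The scalar parameters of the two-tier network. -/
structure Params where
  /-- density of the terrestrial base stations (TBSs) -/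
  lamT : ℝ
  /-- density of the aerial base stations (ABSs) -/
  lamA : ℝ
  /-- common height of the ABSs -/
  h : ℝ
  /-- mmWave line-of-sight radius -/
  RB : ℝ
  /-- main-lobe beamforming gain of a TBS -/
  GM : ℝ
  /-- TBS transmit power -/
  PT : ℝ
  /-- ABS transmit power -/
  PA : ℝ
  /-- NOMA power allocation factor of the near user -/
  an : ℝ
  /-- additive loss constants of TBS, LoS and NLoS links -/
  CT : ℝ
  CL : ℝ
  CN : ℝ
  /-- path loss exponents of TBS, LoS and NLoS links -/
  alphaT : ℝ
  alphaL : ℝ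
  alphaN : ℝ
  lamT_pos : 0 < lamT
  lamA_pos : 0 < lamA
  h_pos : 0 < h
  RB_pos : 0 < RB
  GM_pos : 0 < GM
  PT_pos : 0 < PT
  PA_pos : 0 < PA
  an_pos : 0 < an
  CT_pos : 0 < CT
  CL_pos : 0 < CL
  CN_pos : 0 < CN
  alphaT_pos : 0 < alphaT
  alphaL_pos : 0 < alphaL
  alphaN_pos : 0 < alphaN

namespace Params

/-- `η_T = G_M P_T C_T`. -/
def etaT (p : Params) : ℝ := p.GM * p.PT * p.CT

/-- `η_L = a_n P_A C_L`. -/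
def etaL (p : Params) : ℝ := p.an * p.PA * p.CL

/-- `η_N = a_n P_A C_N`. -/
def etaN (p : Params) : ℝ := p.an * p.PA * p.CN

/-- `Q_T = 1 - exp(-π λ_T R_B²)`. -/
def QT (p : Params) : ℝ := 1 - Real.exp (-(Real.pi * p.lamT * p.RB ^ 2))

/-- `τ_{L|N}(r) = (η_L / η_N)^{1/α_L} r^{α_N/α_L}`. -/
def tauLN (p : Params) (r : ℝ) : ℝ :=
  (p.etaL / p.etaN) ^ (1 / p.alphaL) * r ^ (p.alphaN / p.alphaL)

/-- The density `f_{R_{N,0}}(r)`, `r ≥ h`, of the distance to the nearest NLoS ABS, for the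
LoS probability function `PL` (so that `P_N = 1 - P_L`). -/
def fRN (p : Params) (PL : ℝ → ℝ) (r : ℝ) : ℝ :=
  2 * Real.pi * p.lamA * r * (1 - PL (√(r ^ 2 - p.h ^ 2))) *
    Real.exp (-(2 * Real.pi * p.lamA * ∫ x in (0 : ℝ)..√(r ^ 2 - p.h ^ 2), x * (1 - PL x)))

/-- The integrand of the NLoS association probability. `Real.sqrt` is `0` on negative numbers:
the exponential is `1` when `τ_{L|N}(r) < h`. -/
def integrandN (p : Params) (PL : ℝ → ℝ) (r : ℝ) : ℝ :=
  Real.exp (-(2 * Real.pi * p.lamA * ∫ x in (0 : ℝ)..√(p.tauLN r ^ 2 - p.h ^ 2), x * PL x)) *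
    p.fRN PL r

end Params

/-! ### LoS probability functions -/

/-- `PL x` is a probability for every horizontal distance `x ≥ 0`, and is measurable in `x`. -/
structure IsLoSProbability (PL : ℝ → ℝ) : Prop where
  measurable : Measurable PL
  nonneg : ∀ x, 0 ≤ x → 0 ≤ PL x
  le_one : ∀ x, 0 ≤ x → PL x ≤ 1

/-- The S-curve with the offset `a` subtracted inside the arctangent. -/
def sCurve (a b h x : ℝ) : ℝ :=
  1 / (1 + a * Real.exp (-(b * (180 / Real.pi) * Real.arctan (h / x - a))))

/-- The S-curve with the offset `a` subtracted from the elevation angle in degrees. -/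
def sCurve' (a b h x : ℝ) : ℝ :=
  1 / (1 + a * Real.exp (-(b * (180 / Real.pi * Real.arctan (h / x) - a))))

theorem isLoSProbability_sCurve {a : ℝ} (ha : 0 ≤ a) (b h : ℝ) :
    IsLoSProbability (sCurve a b h) where
  measurable := by
    unfold sCurve
    have := Real.measurable_arctan
    fun_prop
  nonneg x _ := by unfold sCurve; positivity
  le_one x _ := by
    unfold sCurve
    rw [div_le_one (by positivity)]
    have : 0 ≤ a * Real.exp (-(b * (180 / Real.pi) * Real.arctan (h / x - a))) := by positivity
    linarith

theorem isLoSProbability_sCurve' {a : ℝ} (ha : 0 ≤ a) (b h : ℝ) :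
    IsLoSProbability (sCurve' a b h) where
  measurable := by
    unfold sCurve'
    have := Real.measurable_arctan
    fun_prop
  nonneg x _ := by unfold sCurve'; positivity
  le_one x _ := by
    unfold sCurve'
    rw [div_le_one (by positivity)]
    have : 0 ≤ a * Real.exp (-(b * (180 / Real.pi * Real.arctan (h / x) - a))) := by positivity
    linarith

/-! ### Homogeneous Poisson point processes and link states -/

section Processes

variable {Ω : Type*} [MeasurableSpace Ω]

/-- The number of points of the random sequence `X` that lie in `B`. -/
def count (X : ℕ → Ω → Plane) (B : Set Plane) (ω : Ω) : ℕ∞ := {i : ℕ | X i ω ∈ B}.encard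

/-- The random points `X 0, X 1, …` form a homogeneous Poisson point process of density `lam`
in the plane: counts in bounded measurable sets are Poisson with mean `lam * area`, and counts in
pairwise disjoint sets are independent. (For `lam > 0` such a process has infinitely many points,
so it can be listed by a sequence; the order of the list is irrelevant.) -/
structure IsHPPP (μ : Measure Ω) (lam : ℝ) (X : ℕ → Ω → Plane) : Prop where
  measurable : ∀ i, Measurable (X i)
  poisson : ∀ B : Set Plane, MeasurableSet B → Bornology.IsBounded B →
    HasLaw (count X B)
      ((poissonMeasure (Real.toNNReal (lam * (volume : Measure Plane).real B))).map
        (Nat.cast : ℕ → ℕ∞)) μ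
  indep : ∀ (n : ℕ) (B : Fin n → Set Plane), (∀ j, MeasurableSet (B j)) →
    (∀ j, Bornology.IsBounded (B j)) → Pairwise (fun j k => Disjoint (B j) (B k)) →
    iIndepFun (fun j => count X (B j)) μ

/-- State of the link between an ABS and the typical UE. -/
inductive LinkState : Type
  | los
  | nlos

instance : MeasurableSpace LinkState := ⊤

/-- `P_L(x)` and `P_N(x) = 1 - P_L(x)`. -/
def linkProb (PL : ℝ → ℝ) : LinkState → ℝ → ℝ
  | LinkState.los, x => PL x
  | LinkState.nlos, x => 1 - PL x

/-- Given all locations `X`, the link states are independent, and the link to the point `X i` is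
LoS with probability `P_L(‖X i‖)` and NLoS with probability `P_N(‖X i‖)`. -/
structure IsLinkMarking (μ : Measure Ω) (PL : ℝ → ℝ) (X : ℕ → Ω → Plane)
    (S : ℕ → Ω → LinkState) : Prop where
  measurable : ∀ i, Measurable (S i)
  condLaw : ∀ (J : Finset ℕ) (s : ℕ → LinkState),
    μ[Set.indicator {ω | ∀ i ∈ J, S i ω = s i} (fun _ => (1 : ℝ)) |
        MeasurableSpace.comap (fun ω i => X i ω) (inferInstance : MeasurableSpace (ℕ → Plane))]
      =ᵐ[μ] fun ω => ∏ i ∈ J, linkProb PL (s i) ‖X i ω‖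

end Processes

/-! ### Distances, received powers and association -/

section Association

variable {Ω : Type*}

/-- `R_{T,0}`: the least horizontal distance from the UE to a TBS. -/
def RT (Y : ℕ → Ω → Plane) (ω : Ω) : ℝ≥0∞ := ⨅ i : ℕ, ENNReal.ofReal ‖Y i ω‖

/-- `R_{L,0}` and `R_{N,0}`: the least distance (in space) from the UE to an ABS at height `h`
whose link state is `s`; it is `∞` if there is none. -/
def RA (h : ℝ) (X : ℕ → Ω → Plane) (S : ℕ → Ω → LinkState) (s : LinkState) (ω : Ω) : ℝ≥0∞ :=
  ⨅ (i : ℕ) (_ : S i ω = s), ENNReal.ofReal (√(‖X i ω‖ ^ 2 + h ^ 2))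

/-- The kinds of base station a UE can be associated with. -/
inductive Tier : Type
  | tbs
  | los
  | nlos

open Classical in
/-- The average received power from the nearest base station of each kind. TBSs beyond `R_B`
are blocked; `∞ ^ (-α) = 0`, so the power is `0` if there is no station of that kind. -/
def power (p : Params) (Y X : ℕ → Ω → Plane) (S : ℕ → Ω → LinkState) : Tier → Ω → ℝ≥0∞
  | Tier.tbs, ω =>
      if RT Y ω ≤ ENNReal.ofReal p.RB then ENNReal.ofReal p.etaT * RT Y ω ^ (-p.alphaT) else 0
  | Tier.los, ω => ENNReal.ofReal p.etaL * RA p.h X S LinkState.los ω ^ (-p.alphaL)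
  | Tier.nlos, ω => ENNReal.ofReal p.etaN * RA p.h X S LinkState.nlos ω ^ (-p.alphaN)

/-- The event that the UE is associated with a base station of kind `t`: its average received
power exceeds those of the other kinds. -/
def assoc (p : Params) (Y X : ℕ → Ω → Plane) (S : ℕ → Ω → LinkState) (t : Tier) : Set Ω :=
  {ω | ∀ t' : Tier, t' ≠ t → power p Y X S t' ω < power p Y X S t ω}

/-- The event that some TBS lies in `B(0, R_B)`. -/
def tbsInBall (p : Params) (Y : ℕ → Ω → Plane) : Set Ω :=
  {ω | ∃ i, Y i ω ∈ Metric.closedBall (0 : Plane) p.RB}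

end Association

end UAVHetNet

end

/-! Everything rests on the probability that no LoS ABS lies within horizontal distance `u .los` and
no NLoS ABS within `u .nlos`. Given the locations, averaging over the independent link states turns
this event into a product over the points of `g x`, the conditional probability that a point at `x`
is not too close. The generating functional of the Poisson process (`IsHPPP.integral_finprod`) gives
`exp(-λ_A ∫ (1 - g))`. Since `1 - g` is the sum of a LoS and a NLoS term, the result is a product of
two exponentials (`IsLinkMarking.measureReal_forall_le_norm`).

Hence `R_{L,0}` and `R_{N,0}` are independent, with explicit continuous tails and no finite atoms.
Differentiating the tail of `R_{N,0}` gives its density on the finite part (`map_toReal_RA_nlos`);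
there may be further mass at `∞`. As powers decrease with distance, the NLoS power beats the LoS
power when `R_{L,0} > τ_{L|N}(R_{N,0})`, and conditioning on `R_{N,0} = r` yields `I`
(`measure_power_los_lt_power_nlos`), which is finite because it is a probability.

If no TBS lies in the disc, the TBS power almost surely vanishes, so NLoS association is this
comparison alone, and independence of the TBS process supplies the factor `1 - Q_T`. Ties between
the largest powers are null, so the three association events partition the space up to a null set
(`ae_mem_assoc`). -/

namespace UAVHetNet

open Set Filter Topology

/-! ### Generating functional of a Poisson process -/

/-- A finite product over the points in `B` of a function of the cell of the point. -/
theorem finprod_cell {Ω : Type*} {X : ℕ → Ω → Plane} {B : Set Plane} {ω : Ω}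
    (hf : {i | X i ω ∈ B}.Finite) {n : ℕ} (idx : Plane → Fin n) (c : Fin n → ℝ) :
    ∏ᶠ i ∈ {i | X i ω ∈ B}, c (idx (X i ω)) =
      ∏ j, c j ^ (count X (B ∩ idx ⁻¹' {j}) ω).toNat := by
  classical
  rw [finprod_mem_eq_finite_toFinset_prod _ hf,
    ← Finset.prod_fiberwise hf.toFinset (fun i => idx (X i ω))]
  refine Finset.prod_congr rfl fun j _ => ?_
  rw [Finset.prod_congr rfl (g := fun _ => c j) (by simp +contextual), Finset.prod_const]
  congr 1
  have : {i | X i ω ∈ B ∩ idx ⁻¹' {j}} =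
      ((hf.toFinset.filter fun i => idx (X i ω) = j : Finset ℕ) : Set ℕ) := by
    ext i; simp
  rw [count, this, Set.encard_coe_eq_coe_finsetCard, ENat.toNat_natCast]

section PGFL
variable {Ω : Type*} [MeasurableSpace Ω] {μ : Measure Ω}

/-- The probability generating function of a Poisson random variable. -/
theorem integral_pow_of_hasLaw_poisson {K : Ω → ℕ∞} {m : ℝ≥0}
    (hK : HasLaw K ((poissonMeasure m).map (Nat.cast : ℕ → ℕ∞)) μ) (c : ℝ) :
    ∫ ω, c ^ (K ω).toNat ∂μ = Real.exp (-(m * (1 - c))) := by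
  have h1 := hK.integral_comp (f := fun k : ℕ∞ => c ^ k.toNat) .of_discrete
  simp only [Function.comp_def] at h1
  rw [h1, integral_map .of_discrete .of_discrete, integral_poissonMeasure]
  simp only [ENat.toNat_natCast, smul_eq_mul]
  have h2 : HasSum (fun n : ℕ => ((m * c : ℝ) ^ n) / n.factorial) (Real.exp (m * c)) := by
    rw [Real.exp_eq_exp_ℝ]
    exact NormedSpace.expSeries_div_hasSum_exp _
  rw [show -((m : ℝ) * (1 - c)) = -m + m * c by ring, Real.exp_add, ← h2.tsum_eq, ← tsum_mul_left]
  congr with n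
  rw [mul_pow]
  ring

theorem IsHPPP.ae_finite {lam : ℝ} {X : ℕ → Ω → Plane} (h : IsHPPP μ lam X)
    {B : Set Plane} (hB : MeasurableSet B) (hb : Bornology.IsBounded B) :
    ∀ᵐ ω ∂μ, {i | X i ω ∈ B}.Finite := by
  have h1 := h.poisson B hB hb
  have h2 : ∀ᵐ k ∂((poissonMeasure (Real.toNNReal (lam * (volume : Measure Plane).real B))).map
        (Nat.cast : ℕ → ℕ∞)), k ≠ ⊤ := by
    rw [ae_map_iff .of_discrete (.of_discrete)]
    exact ae_of_all _ fun n => ENat.natCast_ne_top n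
  rw [← h1.map_eq, ae_map_iff h1.aemeasurable (.of_discrete)] at h2
  filter_upwards [h2] with ω hω
  simpa [count] using hω

/-- Counts in disjoint cells are independent, so the Poisson generating functions multiply and their
exponents add: this is the generating functional for step functions. -/
theorem IsHPPP.integral_prod_pow_count {lam : ℝ} (hlam : 0 ≤ lam) {X : ℕ → Ω → Plane}
    (h : IsHPPP μ lam X) {n : ℕ} {B : Fin n → Set Plane} (c : Fin n → ℝ)
    (hB : ∀ j, MeasurableSet (B j)) (hb : ∀ j, Bornology.IsBounded (B j))
    (hd : Pairwise (fun j k => Disjoint (B j) (B k))) :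
    ∫ ω, ∏ j, c j ^ (count X (B j) ω).toNat ∂μ =
      Real.exp (-(lam * ∑ j, (volume : Measure Plane).real (B j) * (1 - c j))) := by
  have h1 := (h.indep n B hB hb hd).integral_fun_prod_comp (𝕜 := ℝ)
    (f := fun j (k : ℕ∞) => c j ^ k.toNat)
    (fun j => (h.poisson _ (hB j) (hb j)).aemeasurable) (fun _ => .of_discrete)
  rw [h1, Finset.mul_sum, ← Finset.sum_neg_distrib, Real.exp_sum]
  refine Finset.prod_congr rfl fun j _ => ?_
  rw [integral_pow_of_hasLaw_poisson (h.poisson _ (hB j) (hb j)),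
    Real.coe_toNNReal _ (by positivity)]
  ring_nf

/-- The probability generating functional of a homogeneous Poisson point process. -/
theorem IsHPPP.integral_finprod [IsProbabilityMeasure μ] {lam : ℝ} (hlam : 0 ≤ lam)
    {X : ℕ → Ω → Plane} (h : IsHPPP μ lam X) {B : Set Plane} (hB : MeasurableSet B)
    (hb : Bornology.IsBounded B) {g : Plane → ℝ} (hg : Measurable g) (h0 : ∀ x, 0 ≤ g x)
    (h1 : ∀ x, g x ≤ 1) :
    ∫ ω, ∏ᶠ i ∈ {i | X i ω ∈ B}, g (X i ω) ∂μ =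
      Real.exp (-(lam * ∫ x in B, (1 - g x))) := by
  -- `idx n` records the level `⌊n g⌋` and `c n` its value, so `c n ∘ idx n` is a step function
  -- tending to `g`. The reduction mod `n + 1` in `Fin.ofNat` never acts because `g ≤ 1`; at `n = 0`
  -- the value is `0 / 0 = 0`, which does not affect the limit.
  let idx : ∀ n : ℕ, Plane → Fin (n + 1) := fun n x => Fin.ofNat (n + 1) ⌊g x * n⌋₊
  have idx_meas : ∀ n, Measurable (idx n) := fun n =>
    (Measurable.of_discrete (f := Fin.ofNat (n + 1))).comp
      (Nat.measurable_floor.comp (hg.mul_const _))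
  let c : ∀ n : ℕ, Fin (n + 1) → ℝ := fun n k => (k : ℕ) / (n : ℝ)
  have c0 : ∀ n k, 0 ≤ c n k := fun n k => by positivity
  have c1 : ∀ n k, c n k ≤ 1 := fun n k => div_le_one_of_le₀ (by
    exact_mod_cast Nat.le_of_lt_succ k.2) (by positivity)
  have cidx : ∀ n x, c n (idx n x) = (⌊g x * n⌋₊ : ℝ) / n := fun n x => by
    have : ⌊g x * n⌋₊ ≤ n := by
      apply Nat.floor_le_of_le
      nlinarith [h1 x, (Nat.cast_nonneg n : (0 : ℝ) ≤ n)]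
    simp only [c, idx, Fin.val_ofNat]
    rw [Nat.mod_eq_of_lt (by omega)]
  have clim : ∀ x, Tendsto (fun n => c n (idx n x)) atTop (𝓝 (g x)) := fun x => by
    simp only [cidx]
    exact (tendsto_nat_floor_mul_div_atTop (h0 x)).comp tendsto_natCast_atTop_atTop
  have cell_meas : ∀ n j, MeasurableSet (B ∩ idx n ⁻¹' {j}) := fun n j =>
    hB.inter (idx_meas n (measurableSet_singleton j))
  have cell_bdd : ∀ n j, Bornology.IsBounded (B ∩ idx n ⁻¹' {j}) := fun n j =>
    hb.subset inter_subset_left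
  have cell_disj : ∀ n, Pairwise fun j k => Disjoint (B ∩ idx n ⁻¹' {j}) (B ∩ idx n ⁻¹' {k}) := by
    intro n j k hjk
    rw [Set.disjoint_left]
    rintro x ⟨_, rfl⟩ ⟨_, rfl⟩
    exact hjk rfl
  have key : ∀ n, ∫ ω, ∏ j, c n j ^ (count X (B ∩ idx n ⁻¹' {j}) ω).toNat ∂μ =
      Real.exp (-(lam * ∫ x in B, (1 - c n (idx n x)))) := fun n => by
    rw [h.integral_prod_pow_count hlam (c n) (cell_meas n) (cell_bdd n) (cell_disj n)]
    have hfin : (volume : Measure Plane) B < ∞ := hb.measure_lt_top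
    have hsum : ∀ x, (1 - c n (idx n x)) =
        ∑ j, (idx n ⁻¹' {j}).indicator (fun _ => 1 - c n j) x := fun x => by
      rw [Finset.sum_eq_single (idx n x)]
      · simp
      · intro j _ hj
        simp [Ne.symm hj]
      · simp
    simp_rw [hsum]
    rw [integral_finsetSum]
    · congr 3
      refine Finset.sum_congr rfl fun j _ => ?_
      rw [integral_indicator (idx_meas n (measurableSet_singleton j)),
        Measure.restrict_restrict (idx_meas n (measurableSet_singleton j)), setIntegral_const,
        Set.inter_comm, smul_eq_mul]
    · intro j _
      have : IsFiniteMeasure ((volume : Measure Plane).restrict B) := ⟨by simpa using hfin⟩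
      exact (integrable_const _).indicator (idx_meas n (measurableSet_singleton j))
  have lim1 : Tendsto (fun n => ∫ ω, ∏ j, c n j ^ (count X (B ∩ idx n ⁻¹' {j}) ω).toNat ∂μ) atTop
      (𝓝 (∫ ω, ∏ᶠ i ∈ {i | X i ω ∈ B}, g (X i ω) ∂μ)) := by
    refine tendsto_integral_of_dominated_convergence (fun _ => 1) ?_ (integrable_const _) ?_ ?_
    · intro n
      refine Finset.aestronglyMeasurable_fun_prod _ fun j _ => ?_
      exact ((Measurable.of_discrete (f := fun k : ℕ∞ => c n j ^ k.toNat)).comp_aemeasurable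
        (h.poisson _ (cell_meas n j) (cell_bdd n j)).aemeasurable).aestronglyMeasurable
    · intro n
      refine ae_of_all _ fun ω => ?_
      rw [Real.norm_of_nonneg (Finset.prod_nonneg fun j _ => pow_nonneg (c0 n j) _)]
      exact Finset.prod_le_one (fun j _ => pow_nonneg (c0 n j) _)
        fun j _ => pow_le_one₀ (c0 n j) (c1 n j)
    -- Almost surely only finitely many points lie in `B`, so pointwise convergence of the factors
    -- suffices.
    · filter_upwards [h.ae_finite hB hb] with ω hω
      have e : ∀ n, ∏ j, c n j ^ (count X (B ∩ idx n ⁻¹' {j}) ω).toNat =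
          ∏ i ∈ hω.toFinset, c n (idx n (X i ω)) := fun n => by
        rw [← finprod_cell hω, finprod_mem_eq_finite_toFinset_prod _ hω]
      change Tendsto _ _ (𝓝 (∏ᶠ i ∈ {i | X i ω ∈ B}, g (X i ω)))
      rw [finprod_mem_eq_finite_toFinset_prod _ hω]
      simp_rw [e]
      exact tendsto_finsetProd _ fun i _ => clim _
  have lim2 : Tendsto (fun n => ∫ x in B, (1 - c n (idx n x))) atTop (𝓝 (∫ x in B, (1 - g x))) := by
    have : IsFiniteMeasure ((volume : Measure Plane).restrict B) :=
      ⟨by simpa using hb.measure_lt_top⟩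
    refine tendsto_integral_of_dominated_convergence (fun _ => 1) ?_ (integrable_const _) ?_ ?_
    · intro n
      exact (measurable_const.sub
        ((Measurable.of_discrete (f := c n)).comp (idx_meas n))).aestronglyMeasurable
    · intro n
      refine ae_of_all _ fun x => ?_
      rw [Real.norm_of_nonneg (by linarith [c1 n (idx n x)])]
      linarith [c0 n (idx n x)]
    · exact ae_of_all _ fun x => (clim x).const_sub 1
  refine tendsto_nhds_unique lim1 ?_
  simp_rw [key]
  exact (Real.continuous_exp.tendsto _).comp ((lim2.const_mul lam).neg)

end PGFL

/-! ### Averaging over link states and void probabilities of the marked process -/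

theorem linkProb_nonneg {PL : ℝ → ℝ} (hPL : IsLoSProbability PL) (s : LinkState) {x : ℝ}
    (hx : 0 ≤ x) : 0 ≤ linkProb PL s x := by
  cases s
  · exact hPL.nonneg x hx
  · exact sub_nonneg.2 (hPL.le_one x hx)

theorem linkProb_le_one {PL : ℝ → ℝ} (hPL : IsLoSProbability PL) (s : LinkState) {x : ℝ}
    (hx : 0 ≤ x) : linkProb PL s x ≤ 1 := by
  cases s
  · exact hPL.le_one x hx
  · exact sub_le_self _ (hPL.nonneg x hx)

theorem measurable_linkProb {PL : ℝ → ℝ} (hPL : IsLoSProbability PL) (s : LinkState) :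
    Measurable (linkProb PL s) := by
  cases s
  · exact hPL.measurable
  · exact measurable_const.sub hPL.measurable

/-- Expansion of a product of sums over the two link states. -/
theorem prod_add_linkState (F : ℕ → LinkState → ℝ) (J : Finset ℕ) :
    ∏ i ∈ J, (F i .los + F i .nlos) =
      ∑ A ∈ J.powerset, ∏ i ∈ J, F i (if i ∈ A then .los else .nlos) := by
  rw [Finset.prod_add]
  refine Finset.sum_congr rfl fun A hA => ?_
  rw [← Finset.prod_sdiff (Finset.mem_powerset.1 hA), mul_comm]
  congr 1
  · exact Finset.prod_congr rfl fun i hi => by rw [if_neg (Finset.mem_sdiff.1 hi).2]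
  · exact Finset.prod_congr rfl fun i hi => by rw [if_pos hi]

/-- The bounded `m`-measurable factor `f` moves inside the conditional expectation, which preserves
integrals. -/
theorem integral_mul_eq_of_condExp_ae_eq {Ω : Type*} {m mΩ : MeasurableSpace Ω} {μ : Measure Ω}
    [IsProbabilityMeasure μ] (hm : m ≤ mΩ) {f g g' : Ω → ℝ} {c : ℝ} (hf : StronglyMeasurable[m] f)
    (hb : ∀ ω, ‖f ω‖ ≤ c) (hg : Integrable g μ) (hg' : μ[g|m] =ᵐ[μ] g') :
    ∫ ω, f ω * g ω ∂μ = ∫ ω, f ω * g' ω ∂μ := by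
  have h1 := condExp_stronglyMeasurable_mul_of_bound hm hf hg c (ae_of_all _ hb)
  have h2 := integral_condExp hm (μ := μ) (f := f * g)
  rw [integral_congr_ae h1] at h2
  refine h2.symm.trans (integral_congr_ae ?_)
  filter_upwards [hg'] with ω hω
  simp only [Pi.mul_apply, hω]

theorem IsLinkMarking.measurableSet_eq {Ω : Type*} [MeasurableSpace Ω] {μ : Measure Ω}
    {PL : ℝ → ℝ} {X : ℕ → Ω → Plane} {S : ℕ → Ω → LinkState} (hS : IsLinkMarking μ PL X S)
    (J : Finset ℕ) (s : ℕ → LinkState) : MeasurableSet {ω | ∀ i ∈ J, S i ω = s i} := by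
  have : {ω | ∀ i ∈ J, S i ω = s i} = ⋂ i ∈ J, S i ⁻¹' {s i} := by ext; simp
  rw [this]
  exact Finset.measurableSet_biInter _ fun i _ => hS.measurable i trivial

section Marking
variable {Ω : Type*} [MeasurableSpace Ω] {μ : Measure Ω} [IsProbabilityMeasure μ]
  {PL : ℝ → ℝ} {X : ℕ → Ω → Plane} {S : ℕ → Ω → LinkState}

/-- Once a pattern `s` of states is fixed, the factor `∏ t (s i) (X i)` depends on the locations
only, so the conditional law of the states applies. -/
theorem IsLinkMarking.integral_indicator_mul_prod (hS : IsLinkMarking μ PL X S)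
    (hX : ∀ i, Measurable (X i)) {t : LinkState → Plane → ℝ} (ht : ∀ s, Measurable (t s))
    (t0 : ∀ s x, 0 ≤ t s x) (t1 : ∀ s x, t s x ≤ 1) (J : Finset ℕ) (s : ℕ → LinkState) :
    ∫ ω, (∏ i ∈ J, t (s i) (X i ω)) * indicator {ω | ∀ i ∈ J, S i ω = s i} (fun _ => (1 : ℝ)) ω ∂μ =
      ∫ ω, (∏ i ∈ J, t (s i) (X i ω)) * ∏ i ∈ J, linkProb PL (s i) ‖X i ω‖ ∂μ := by
  refine integral_mul_eq_of_condExp_ae_eq (c := 1) (measurable_pi_lambda _ hX).comap_le ?_ ?_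
    ((integrable_const _).indicator (hS.measurableSet_eq J s)) (hS.condLaw J s)
  · have h1 : Measurable (fun x : ℕ → Plane => ∏ i ∈ J, t (s i) (x i)) :=
      Finset.measurable_fun_prod _ fun i _ => (ht _).comp (measurable_pi_apply i)
    exact (h1.comp (comap_measurable _)).stronglyMeasurable
  · intro ω
    rw [Real.norm_of_nonneg (Finset.prod_nonneg fun i _ => t0 _ _)]
    exact Finset.prod_le_one (fun i _ => t0 _ _) fun i _ => t1 _ _

/-- Splitting by the set `A` of LoS indices in `J`, treating each pattern separately and summing
again averages out the marks: each point contributes the mean of `t` over its own state. -/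
theorem IsLinkMarking.integral_prod (hPL : IsLoSProbability PL) (hS : IsLinkMarking μ PL X S)
    (hX : ∀ i, Measurable (X i)) {t : LinkState → Plane → ℝ} (ht : ∀ s, Measurable (t s))
    (t0 : ∀ s x, 0 ≤ t s x) (t1 : ∀ s x, t s x ≤ 1) (J : Finset ℕ) :
    ∫ ω, ∏ i ∈ J, t (S i ω) (X i ω) ∂μ =
      ∫ ω, ∏ i ∈ J, (t .los (X i ω) * linkProb PL .los ‖X i ω‖ +
        t .nlos (X i ω) * linkProb PL .nlos ‖X i ω‖) ∂μ := by
  classical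
  have e1 : ∀ ω, ∏ i ∈ J, t (S i ω) (X i ω) = ∑ A ∈ J.powerset,
      (∏ i ∈ J, t (if i ∈ A then .los else .nlos) (X i ω)) *
        indicator {ω | ∀ i ∈ J, S i ω = (if i ∈ A then .los else .nlos)} (fun _ => (1 : ℝ)) ω := by
    intro ω
    have h := prod_add_linkState (fun i s => t s (X i ω) * if S i ω = s then 1 else 0) J
    refine (Finset.prod_congr rfl fun i _ => ?_).trans (h.trans ?_)
    · cases S i ω <;> simp
    · refine Finset.sum_congr rfl fun A _ => ?_
      rw [Finset.prod_mul_distrib, Finset.prod_boole]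
      simp [indicator]
  have e2 : ∀ ω, ∏ i ∈ J, (t .los (X i ω) * linkProb PL .los ‖X i ω‖ +
        t .nlos (X i ω) * linkProb PL .nlos ‖X i ω‖) = ∑ A ∈ J.powerset,
      (∏ i ∈ J, t (if i ∈ A then .los else .nlos) (X i ω)) *
        ∏ i ∈ J, linkProb PL (if i ∈ A then .los else .nlos) ‖X i ω‖ := by
    intro ω
    rw [prod_add_linkState (fun i s => t s (X i ω) * linkProb PL s ‖X i ω‖) J]
    exact Finset.sum_congr rfl fun A _ => Finset.prod_mul_distrib
  simp_rw [e1, e2]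
  have bnd : ∀ (A : Finset ℕ) ω, ‖∏ i ∈ J, t (if i ∈ A then .los else .nlos) (X i ω)‖ ≤ 1 := by
    intro A ω
    rw [Real.norm_of_nonneg (Finset.prod_nonneg fun i _ => t0 _ _)]
    exact Finset.prod_le_one (fun i _ => t0 _ _) fun i _ => t1 _ _
  have meas : ∀ A : Finset ℕ, Measurable fun ω =>
      ∏ i ∈ J, t (if i ∈ A then .los else .nlos) (X i ω) := fun A =>
    Finset.measurable_fun_prod _ fun i _ => (ht _).comp (hX i)
  rw [integral_finsetSum, integral_finsetSum]
  · exact Finset.sum_congr rfl fun A _ => hS.integral_indicator_mul_prod hX ht t0 t1 J _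
  · intro A _
    refine Integrable.bdd_mul (c := 1) ?_ (meas A).aestronglyMeasurable (ae_of_all _ (bnd A))
    refine Integrable.of_bound (C := 1) ?_ (ae_of_all _ fun ω => ?_)
    · exact (Finset.measurable_fun_prod _ fun i _ =>
        (measurable_linkProb hPL _).comp (hX i).norm).aestronglyMeasurable
    · rw [Real.norm_of_nonneg (Finset.prod_nonneg fun i _ => linkProb_nonneg hPL _ (norm_nonneg _))]
      exact Finset.prod_le_one (fun i _ => linkProb_nonneg hPL _ (norm_nonneg _))
        fun i _ => linkProb_le_one hPL _ (norm_nonneg _)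
  · intro A _
    refine Integrable.bdd_mul (c := 1) ?_ (meas A).aestronglyMeasurable (ae_of_all _ (bnd A))
    exact (integrable_const _).indicator (hS.measurableSet_eq J _)

/-- Polar coordinates for a radial function on a disc. -/
theorem setIntegral_ball_norm (f : ℝ → ℝ) {u : ℝ} (hu : 0 ≤ u) :
    ∫ x in Metric.ball (0 : Plane) u, f ‖x‖ = 2 * Real.pi * ∫ x in (0 : ℝ)..u, x * f x := by
  have h := integral_fun_norm_addHaar (volume : Measure Plane) ((Iio u).indicator f)
  have h1 : ∀ x : Plane, (Iio u).indicator f ‖x‖ =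
      (Metric.ball (0 : Plane) u).indicator (fun x => f ‖x‖) x := fun x => by
    simp [indicator]
  simp_rw [h1] at h
  rw [integral_indicator Metric.isOpen_ball.measurableSet] at h
  rw [h, intervalIntegral.integral_of_le hu, integral_Ioc_eq_integral_Ioo, ← Ioi_inter_Iio,
    Set.inter_comm, ← Measure.restrict_restrict measurableSet_Iio,
    ← integral_indicator measurableSet_Iio]
  have h2 : (volume : Measure Plane).real (Metric.ball 0 1) = Real.pi := by
    simp [measureReal_def, Real.pi_pos.le]
  rw [h2, finrank_euclideanSpace_fin]
  simp only [nsmul_eq_mul, smul_eq_mul, Nat.cast_ofNat, Nat.add_one_sub_one, pow_one, mul_assoc]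
  congr 3
  funext y
  simp [indicator]

/-- The probability that no LoS ABS is closer than `u .los` and no NLoS ABS is closer than
`u .nlos`. -/
theorem IsLinkMarking.measureReal_forall_le_norm {lam : ℝ} (hlam : 0 ≤ lam)
    (hPL : IsLoSProbability PL) (hS : IsLinkMarking μ PL X S) (hX : IsHPPP μ lam X)
    {u : LinkState → ℝ} (hu : ∀ s, 0 ≤ u s) :
    μ.real {ω | ∀ i, u (S i ω) ≤ ‖X i ω‖} =
      Real.exp (-(2 * Real.pi * lam * ∫ x in (0 : ℝ)..u .los, x * linkProb PL .los x)) *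
      Real.exp (-(2 * Real.pi * lam * ∫ x in (0 : ℝ)..u .nlos, x * linkProb PL .nlos x)) := by
  classical
  -- `t` indicates that a point is not too close for its state; `g` below is its mean over the
  -- state, given the location.
  let t : LinkState → Plane → ℝ := fun s x => if u s ≤ ‖x‖ then 1 else 0
  have ht : ∀ s, Measurable (t s) := fun s =>
    Measurable.ite (measurableSet_le measurable_const measurable_norm) measurable_const
      measurable_const
  have t0 : ∀ s x, 0 ≤ t s x := fun s x => by simp only [t]; split_ifs <;> norm_num
  have t1 : ∀ s x, t s x ≤ 1 := fun s x => by simp only [t]; split_ifs <;> norm_num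
  let g : Plane → ℝ := fun x => t .los x * linkProb PL .los ‖x‖ + t .nlos x * linkProb PL .nlos ‖x‖
  have hsum : ∀ y, linkProb PL .los y + linkProb PL .nlos y = 1 := fun y => by simp [linkProb]
  have l0 : ∀ s (x : Plane), 0 ≤ linkProb PL s ‖x‖ := fun s x =>
    linkProb_nonneg hPL s (norm_nonneg x)
  have hg : Measurable g :=
    ((ht _).mul ((measurable_linkProb hPL _).comp measurable_norm)).add
      ((ht _).mul ((measurable_linkProb hPL _).comp measurable_norm))
  have g0 : ∀ x, 0 ≤ g x := fun x =>
    add_nonneg (mul_nonneg (t0 _ _) (l0 _ _)) (mul_nonneg (t0 _ _) (l0 _ _))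
  have g1 : ∀ x, g x ≤ 1 := fun x => by
    rw [← hsum ‖x‖]
    exact add_le_add (mul_le_of_le_one_left (l0 _ _) (t1 _ _))
      (mul_le_of_le_one_left (l0 _ _) (t1 _ _))
  -- Beyond `R` no point can violate the event, so `g = 1` there and the product over all points
  -- reduces to the finitely many points of a ball.
  set R := max (u .los) (u .nlos) with hR
  have goff : ∀ x, x ∉ Metric.ball (0 : Plane) R → g x = 1 := fun x hx => by
    have hx' : R ≤ ‖x‖ := by simpa using hx
    simp only [g, t, if_pos ((le_max_left _ _).trans hx'), if_pos ((le_max_right _ _).trans hx'),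
      one_mul, hsum]
  have lim1 : Tendsto (fun N => ∫ ω, ∏ i ∈ Finset.range N, t (S i ω) (X i ω) ∂μ) atTop
      (𝓝 (μ.real {ω | ∀ i, u (S i ω) ≤ ‖X i ω‖})) := by
    have hu' : ∀ i, Measurable fun ω => u (S i ω) := fun i =>
      (measurable_from_top (f := u)).comp (hS.measurable i)
    have ok_meas : ∀ i, MeasurableSet {ω | u (S i ω) ≤ ‖X i ω‖} := fun i =>
      measurableSet_le (hu' i) (hX.measurable i).norm
    rw [← integral_indicator_one (by rw [ofPred_forall]; exact MeasurableSet.iInter ok_meas)]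
    refine tendsto_integral_of_dominated_convergence (fun _ => 1) ?_ (integrable_const _) ?_ ?_
    · intro N
      exact (Finset.measurable_fun_prod _ fun i _ => Measurable.ite (ok_meas i) measurable_const
        measurable_const).aestronglyMeasurable
    · intro N
      refine ae_of_all _ fun ω => ?_
      rw [Real.norm_of_nonneg (Finset.prod_nonneg fun i _ => t0 _ _)]
      exact Finset.prod_le_one (fun i _ => t0 _ _) fun i _ => t1 _ _
    · refine ae_of_all _ fun ω => tendsto_const_nhds.congr' ?_
      by_cases h : ∀ i, u (S i ω) ≤ ‖X i ω‖
      · exact Eventually.of_forall fun N => by simp [t, h]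
      · obtain ⟨i, hi⟩ := not_forall.1 h
        filter_upwards [eventually_gt_atTop i] with N hN
        rw [indicator_of_notMem (by exact h), Finset.prod_eq_zero (Finset.mem_range.2 hN)]
        simp only [t, if_neg hi]
  have lim2 : Tendsto (fun N => ∫ ω, ∏ i ∈ Finset.range N, g (X i ω) ∂μ) atTop
      (𝓝 (∫ ω, ∏ᶠ i ∈ {i | X i ω ∈ Metric.ball (0 : Plane) R}, g (X i ω) ∂μ)) := by
    refine tendsto_integral_of_dominated_convergence (fun _ => 1) ?_ (integrable_const _) ?_ ?_
    · intro N
      exact (Finset.measurable_fun_prod _ fun i _ => hg.comp (hX.measurable i)).aestronglyMeasurable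
    · intro N
      refine ae_of_all _ fun ω => ?_
      rw [Real.norm_of_nonneg (Finset.prod_nonneg fun i _ => g0 _)]
      exact Finset.prod_le_one (fun i _ => g0 _) fun i _ => g1 _
    · filter_upwards [hX.ae_finite Metric.isOpen_ball.measurableSet Metric.isBounded_ball] with ω hω
      change Tendsto _ _ (𝓝 (∏ᶠ i ∈ {i | X i ω ∈ Metric.ball (0 : Plane) R}, g (X i ω)))
      rw [finprod_mem_eq_finite_toFinset_prod _ hω]
      refine tendsto_const_nhds.congr' ?_
      obtain ⟨N, hN⟩ := hω.toFinset.exists_nat_subset_range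
      filter_upwards [eventually_ge_atTop N] with M hM
      refine Finset.prod_subset (hN.trans (Finset.range_mono hM)) fun i _ hi => goff _ ?_
      simpa using hi
  rw [hX.integral_finprod hlam Metric.isOpen_ball.measurableSet Metric.isBounded_ball hg g0 g1]
    at lim2
  simp_rw [hS.integral_prod hPL hX.measurable ht t0 t1] at lim1
  rw [tendsto_nhds_unique lim1 lim2, ← Real.exp_add]
  have ball_int : ∀ s, IntegrableOn ((Metric.ball (0 : Plane) (u s)).indicator
      (fun x => linkProb PL s ‖x‖)) (Metric.ball (0 : Plane) R) := by
    intro s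
    have : IsFiniteMeasure ((volume : Measure Plane).restrict (Metric.ball (0 : Plane) R)) :=
      ⟨by rw [Measure.restrict_apply_univ]; exact measure_ball_lt_top⟩
    refine Integrable.indicator ?_ Metric.isOpen_ball.measurableSet
    refine Integrable.of_bound (C := 1)
      ((measurable_linkProb hPL s).comp measurable_norm).aestronglyMeasurable
      (ae_of_all _ fun x => ?_)
    rw [Real.norm_of_nonneg (l0 s x)]
    exact linkProb_le_one hPL s (norm_nonneg x)
  have hres : ∀ s, ∫ x in Metric.ball (0 : Plane) R, (Metric.ball (0 : Plane) (u s)).indicator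
      (fun x => linkProb PL s ‖x‖) x =
      2 * Real.pi * ∫ x in (0 : ℝ)..u s, x * linkProb PL s x := fun s => by
    rw [← setIntegral_ball_norm _ (hu s), integral_indicator Metric.isOpen_ball.measurableSet,
      Measure.restrict_restrict Metric.isOpen_ball.measurableSet, inter_eq_left.2]
    exact Metric.ball_subset_ball (by cases s <;> simp [hR])
  -- One term per state, each supported in its own ball: this additivity is the source of the
  -- independence of the two distances.
  have hsplit : ∀ x, 1 - g x = (Metric.ball (0 : Plane) (u .los)).indicator
      (fun x => linkProb PL .los ‖x‖) x + (Metric.ball (0 : Plane) (u .nlos)).indicator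
      (fun x => linkProb PL .nlos ‖x‖) x := fun x => by
    have := hsum ‖x‖
    simp only [g, t, indicator, Metric.mem_ball, dist_zero_right]
    split_ifs <;> linarith
  simp_rw [hsplit]
  rw [integral_add (ball_int _) (ball_int _), hres, hres]
  congr 1
  ring

end Marking

/-! ### Tail events of the nearest distances -/

theorem measurable_RA {Ω : Type*} [MeasurableSpace Ω] (h : ℝ) {X : ℕ → Ω → Plane}
    {S : ℕ → Ω → LinkState} (hX : ∀ i, Measurable (X i)) (hS : ∀ i, Measurable (S i))
    (s : LinkState) : Measurable (RA h X S s) := by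
  classical
  refine Measurable.iInf fun i => ?_
  simp_rw [iInf_eq_if]
  refine Measurable.ite (hS i (t := {s}) trivial) ?_ measurable_const
  exact ENNReal.measurable_ofReal.comp (((hX i).norm.pow_const 2).add_const _).sqrt

theorem measurable_RT {Ω : Type*} [MeasurableSpace Ω] {Y : ℕ → Ω → Plane}
    (hY : ∀ i, Measurable (Y i)) : Measurable (RT Y) :=
  Measurable.iInf fun i => ENNReal.measurable_ofReal.comp (hY i).norm

/-- Pythagoras. When `a ^ 2 < h ^ 2` the root is `0` and the condition is void, as it must be for
stations at height `h`. -/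
theorem ofReal_le_RA_iff {Ω : Type*} {h a : ℝ} (ha : 0 ≤ a) {X : ℕ → Ω → Plane}
    {S : ℕ → Ω → LinkState} {s : LinkState} {ω : Ω} :
    ENNReal.ofReal a ≤ RA h X S s ω ↔ ∀ i, S i ω = s → √(a ^ 2 - h ^ 2) ≤ ‖X i ω‖ := by
  simp only [RA, le_iInf_iff]
  refine forall_congr' fun i => imp_congr_right fun _ => ?_
  rw [ENNReal.ofReal_le_ofReal_iff (Real.sqrt_nonneg _), Real.le_sqrt ha,
    Real.sqrt_le_left (norm_nonneg _), sub_le_iff_le_add]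
  positivity

theorem ofReal_le_RT_iff {Ω : Type*} {a : ℝ} {Y : ℕ → Ω → Plane} {ω : Ω} :
    ENNReal.ofReal a ≤ RT Y ω ↔ ∀ i, a ≤ ‖Y i ω‖ := by
  simp only [RT, le_iInf_iff]
  exact forall_congr' fun i => ENNReal.ofReal_le_ofReal_iff (norm_nonneg _)

/-- The point of index `0` has one of the two states, so the two ABS distances are never both
infinite. This excludes a tie of LoS and NLoS powers at `0`. -/
theorem RA_ne_top {Ω : Type*} {h : ℝ} {X : ℕ → Ω → Plane} {S : ℕ → Ω → LinkState} (ω : Ω) :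
    RA h X S (S 0 ω) ω ≠ ⊤ :=
  ne_top_of_le_ne_top (ENNReal.ofReal_ne_top (r := √(‖X 0 ω‖ ^ 2 + h ^ 2)))
    (iInf₂_le (f := fun i (_ : S i ω = S 0 ω) => ENNReal.ofReal √(‖X i ω‖ ^ 2 + h ^ 2)) 0 rfl)

theorem RT_ne_top {Ω : Type*} {Y : ℕ → Ω → Plane} (ω : Ω) : RT Y ω ≠ ⊤ :=
  ne_top_of_le_ne_top ENNReal.ofReal_ne_top (iInf_le _ (0 : ℕ))

/-- The void probability of a homogeneous Poisson point process. -/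
theorem IsHPPP.measureReal_forall_notMem {Ω : Type*} [MeasurableSpace Ω] {μ : Measure Ω}
    {lam : ℝ} (hlam : 0 ≤ lam) {Y : ℕ → Ω → Plane} (hY : IsHPPP μ lam Y) {B : Set Plane}
    (hB : MeasurableSet B) (hb : Bornology.IsBounded B) :
    μ.real {ω | ∀ i, Y i ω ∉ B} = Real.exp (-(lam * (volume : Measure Plane).real B)) := by
  have h1 := hY.poisson B hB hb
  have h2 : {ω | ∀ i, Y i ω ∉ B} = count Y B ⁻¹' {0} := by
    ext ω
    simp [count, Set.eq_empty_iff_forall_notMem]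
  have h3 : (Nat.cast : ℕ → ℕ∞) ⁻¹' {0} = {0} := by ext n; simp
  rw [h2, measureReal_def, ← Measure.map_apply_of_aemeasurable h1.aemeasurable (by trivial),
    h1.map_eq, Measure.map_apply .of_discrete (by trivial), h3, ← measureReal_def,
    poissonMeasure_real_singleton, Real.coe_toNNReal _ (by positivity)]
  simp

theorem IsHPPP.measureReal_ofReal_le_RT {Ω : Type*} [MeasurableSpace Ω] {μ : Measure Ω}
    {lam : ℝ} (hlam : 0 ≤ lam) {Y : ℕ → Ω → Plane} (hY : IsHPPP μ lam Y) {a : ℝ} (ha : 0 ≤ a) :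
    μ.real {ω | ENNReal.ofReal a ≤ RT Y ω} = Real.exp (-(Real.pi * lam * a ^ 2)) := by
  have h := hY.measureReal_forall_notMem hlam (B := Metric.ball 0 a)
    Metric.isOpen_ball.measurableSet Metric.isBounded_ball
  simp_rw [ofReal_le_RT_iff]
  simp only [Metric.mem_ball, dist_zero_right, not_lt] at h
  rw [h]
  congr 2
  simp [measureReal_def, Real.pi_pos.le, ENNReal.toReal_ofReal ha]
  ring

/-! ### Atoms, independence and ties of random variables in `[0, ∞]` -/

/-- A random variable with continuous survival function has no finite atom. -/
theorem measure_eq_ofReal_eq_zero {Ω : Type*} [MeasurableSpace Ω] {μ : Measure Ω}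
    [IsProbabilityMeasure μ] {U : Ω → ℝ≥0∞} (hU : Measurable U) {G : ℝ → ℝ} (hG : Continuous G)
    (h : ∀ a, 0 ≤ a → μ.real {ω | ENNReal.ofReal a ≤ U ω} = G a) {a : ℝ} (ha : 0 ≤ a) :
    μ {ω | U ω = ENNReal.ofReal a} = 0 := by
  rw [← measureReal_eq_zero_iff]
  refine le_antisymm ?_ measureReal_nonneg
  -- For `b > a` the event `U = a` lies in `{a ≤ U} \ {b ≤ U}`, of probability `G a - G b`, which
  -- tends to `0` as `b ↓ a`.
  have hlim : Tendsto (fun b => G a - G b) (𝓝[>] a) (𝓝 (G a - G a)) :=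
    ((hG.tendsto a).const_sub (G a)).mono_left nhdsWithin_le_nhds
  rw [sub_self] at hlim
  refine ge_of_tendsto hlim ?_
  filter_upwards [self_mem_nhdsWithin] with b hb
  have hb : a < b := hb
  have hb0 : 0 < b := ha.trans_lt hb
  rw [← h a ha, ← h b hb0.le, ← measureReal_sdiff]
  · refine measureReal_mono ?_
    intro ω hω
    have hω : U ω = ENNReal.ofReal a := hω
    simp only [Set.mem_sdiff, mem_ofPred_eq, hω, le_refl, true_and, not_le]
    exact (ENNReal.ofReal_lt_ofReal_iff hb0).2 hb
  · intro ω hω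
    exact (ENNReal.ofReal_le_ofReal hb.le).trans hω
  · exact measurableSet_le measurable_const hU

/-- Tails are computed at finite levels only; the remaining ray `{∞}` is the intersection of the
rays at the integers. -/
theorem borel_ennreal_eq_generateFrom_Ici_ofReal :
    ENNReal.measurableSpace =
      MeasurableSpace.generateFrom {t | ∃ a : ℝ, 0 ≤ a ∧ Ici (ENNReal.ofReal a) = t} := by
  refine le_antisymm ?_ ?_
  · rw [BorelSpace.measurable_eq (α := ℝ≥0∞), borel_eq_generateFrom_Ici]
    refine MeasurableSpace.generateFrom_le ?_
    rintro _ ⟨a, rfl⟩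
    have hfin : ∀ b : ℝ, 0 ≤ b → MeasurableSet[MeasurableSpace.generateFrom
        {t | ∃ a : ℝ, 0 ≤ a ∧ Ici (ENNReal.ofReal a) = t}] (Ici (ENNReal.ofReal b)) :=
      fun b hb => MeasurableSpace.measurableSet_generateFrom ⟨b, hb, rfl⟩
    by_cases ha : a = ⊤
    · have : Ici a = ⋂ n : ℕ, Ici (ENNReal.ofReal n) := by
        ext x
        simp only [ha, mem_Ici, top_le_iff, mem_iInter, ENNReal.ofReal_natCast]
        refine ⟨fun h => by simp [h], fun h => ?_⟩
        by_contra hx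
        obtain ⟨n, hn⟩ := ENNReal.exists_nat_gt hx
        exact absurd (h n) (not_le.2 hn)
      rw [this]
      exact MeasurableSet.iInter fun n => hfin n n.cast_nonneg
    · rw [← ENNReal.ofReal_toReal ha]
      exact hfin _ ENNReal.toReal_nonneg
  · refine MeasurableSpace.generateFrom_le ?_
    rintro _ ⟨a, _, rfl⟩
    exact measurableSet_Ici

/-- The rays at finite levels form a π-system generating the σ-algebra, so it is enough that the
joint tails factor. -/
theorem indepFun_of_measure_ofReal_le {Ω : Type*} [MeasurableSpace Ω] {μ : Measure Ω}
    [IsProbabilityMeasure μ] {U V : Ω → ℝ≥0∞} (hU : Measurable U) (hV : Measurable V)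
    (h : ∀ a b : ℝ, 0 ≤ a → 0 ≤ b →
      μ.real {ω | ENNReal.ofReal a ≤ U ω ∧ ENNReal.ofReal b ≤ V ω} =
        μ.real {ω | ENNReal.ofReal a ≤ U ω} * μ.real {ω | ENNReal.ofReal b ≤ V ω}) :
    IndepFun U V μ := by
  have hpi : IsPiSystem {t : Set ℝ≥0∞ | ∃ a : ℝ, 0 ≤ a ∧ Ici (ENNReal.ofReal a) = t} := by
    rintro _ ⟨a, ha, rfl⟩ _ ⟨b, hb, rfl⟩ _
    refine ⟨max a b, ha.trans (le_max_left _ _), ?_⟩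
    rw [Ici_inter_Ici, ENNReal.ofReal_max]
  rw [IndepFun_iff_Indep]
  refine IndepSets.indep hU.comap_le hV.comap_le (hpi.comap U) (hpi.comap V) ?_ ?_ ?_
  · conv_lhs => rw [borel_ennreal_eq_generateFrom_Ici_ofReal]
    rw [MeasurableSpace.comap_generateFrom]
    rfl
  · conv_lhs => rw [borel_ennreal_eq_generateFrom_Ici_ofReal]
    rw [MeasurableSpace.comap_generateFrom]
    rfl
  · rw [IndepSets_iff]
    rintro _ _ ⟨_, ⟨a, ha, rfl⟩, rfl⟩ ⟨_, ⟨b, hb, rfl⟩, rfl⟩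
    have := h a b ha hb
    rw [measureReal_def, measureReal_def, measureReal_def, ← ENNReal.toReal_mul,
      ENNReal.toReal_eq_toReal_iff' (measure_ne_top _ _)
        (ENNReal.mul_ne_top (measure_ne_top _ _) (measure_ne_top _ _))] at this
    exact this

/-- Two independent random variables almost surely do not tie. -/
theorem measure_tie_eq_zero {Ω : Type*} [MeasurableSpace Ω] {μ : Measure Ω}
    [IsProbabilityMeasure μ] {U V : Ω → ℝ≥0∞} (hU : Measurable U) (hV : Measurable V)
    (hUV : IndepFun U V μ) (hV0 : ∀ a, 0 ≤ a → μ {ω | V ω = ENNReal.ofReal a} = 0)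
    {f g : ℝ≥0∞ → ℝ≥0∞} (hf : Measurable f) (hg : Measurable g) (hinj : Function.Injective g) :
    μ {ω | f (U ω) = g (V ω) ∧ V ω ≠ ⊤} = 0 := by
  let D : Set (ℝ≥0∞ × ℝ≥0∞) := {q | f q.1 = g q.2 ∧ q.2 ≠ ⊤}
  have hD : MeasurableSet D :=
    (measurableSet_eq_fun (hf.comp measurable_fst) (hg.comp measurable_snd)).inter
      (measurable_snd (measurableSet_singleton ⊤).compl)
  change μ ((fun ω => (U ω, V ω)) ⁻¹' D) = 0
  rw [← Measure.map_apply (hU.prodMk hV) hD,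
    (indepFun_iff_map_prod_eq_prod_map_map hU.aemeasurable hV.aemeasurable).1 hUV,
    Measure.measure_prod_null hD]
  -- For fixed `u`, injectivity of `g` leaves at most one finite value of `V` in the slice. The
  -- value `∞` is excluded because `V` may have an atom there.
  refine ae_of_all _ fun u => ?_
  change μ.map V (Prod.mk u ⁻¹' D) = 0
  rw [Measure.map_apply hV (measurable_prodMk_left hD)]
  by_cases hex : ∃ a : ℝ, 0 ≤ a ∧ f u = g (ENNReal.ofReal a)
  · obtain ⟨a, ha, hfa⟩ := hex
    refine measure_mono_null ?_ (hV0 a ha)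
    rintro ω ⟨h1, _⟩
    exact hinj (h1.symm.trans hfa)
  · refine measure_mono_null ?_ measure_empty
    rintro ω ⟨h1, h2⟩
    refine hex ⟨(V ω).toReal, ENNReal.toReal_nonneg, ?_⟩
    rw [ENNReal.ofReal_toReal h2]
    exact h1

/-- Strictness extends to the endpoints, with value `∞` at `0` and `0` at `∞`, so a missing station
needs no separate treatment. -/
theorem strictAnti_ofReal_mul_rpow {η α : ℝ} (hη : 0 < η) (hα : 0 < α) :
    StrictAnti fun x : ℝ≥0∞ => ENNReal.ofReal η * x ^ (-α) := by
  intro x y hxy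
  refine (ENNReal.mul_lt_mul_iff_right (by simpa using hη) ENNReal.ofReal_ne_top).2 ?_
  rw [ENNReal.rpow_neg, ENNReal.rpow_neg, ENNReal.inv_lt_inv]
  exact ENNReal.rpow_lt_rpow hxy hα

/-! ### Survival functions and the density of the NLoS distance -/

/-- For `s ≤ t` the difference is `exp (-s) * (1 - exp (s - t)) ≤ t - s`. It makes survival
functions Lipschitz. -/
theorem abs_exp_neg_sub_exp_neg_le {s t : ℝ} (hs : 0 ≤ s) (ht : 0 ≤ t) :
    |Real.exp (-s) - Real.exp (-t)| ≤ |s - t| := by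
  wlog hst : s ≤ t generalizing s t
  · rw [abs_sub_comm, abs_sub_comm s]
    exact this ht hs (le_of_not_ge hst)
  have h1 : Real.exp (-t) ≤ Real.exp (-s) := Real.exp_le_exp.2 (by linarith)
  rw [abs_of_nonneg (by linarith), abs_of_nonpos (by linarith)]
  have h2 : Real.exp (-t) = Real.exp (-s) * Real.exp (s - t) := by rw [← Real.exp_add]; ring_nf
  have h3 := Real.add_one_le_exp (s - t)
  have h4 : Real.exp (-s) ≤ 1 := Real.exp_le_one_iff.2 (by linarith)
  have h5 := Real.exp_pos (-s)
  rw [h2]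
  nlinarith

/-- The survival function `exp (-∫ k)` has density `k * exp (-∫ k)`. -/
theorem integral_mul_exp_neg_primitive {k : ℝ → ℝ} (hk : LocallyIntegrable k volume) {h a b C : ℝ}
    (ha : h ≤ a) (hab : a ≤ b) (hk0 : ∀ r, h ≤ r → 0 ≤ k r) (hC : ∀ r ∈ Icc a b, k r ≤ C) :
    ∫ r in a..b, k r * Real.exp (-∫ x in h..r, k x) =
      Real.exp (-∫ x in h..a, k x) - Real.exp (-∫ x in h..b, k x) := by
  have hint : ∀ x y, IntervalIntegrable k volume x y := fun x y =>
    intervalIntegrable_iff.2 ((hk.integrableOn_isCompact isCompact_uIcc).mono_set uIoc_subset_uIcc)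
  set G : ℝ → ℝ := fun r => Real.exp (-∫ x in h..r, k x) with hG
  -- `k` is only locally integrable, so `G` need not be differentiable everywhere. The bound `C`
  -- makes `G` Lipschitz, hence absolutely continuous, and its almost everywhere derivative
  -- suffices.
  have hK0 : ∀ r, h ≤ r → 0 ≤ ∫ x in h..r, k x := fun r hr =>
    intervalIntegral.integral_nonneg hr fun x hx => hk0 x hx.1
  have hC0 : 0 ≤ C := (hk0 a ha).trans (hC a (left_mem_Icc.2 hab))
  have hlip : LipschitzOnWith C.toNNReal G (uIcc a b) := by
    rw [uIcc_of_le hab]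
    refine LipschitzOnWith.of_dist_le_mul fun x hx y hy => ?_
    rw [Real.dist_eq, Real.dist_eq, Real.coe_toNNReal C hC0]
    refine (abs_exp_neg_sub_exp_neg_le (hK0 x (ha.trans hx.1)) (hK0 y (ha.trans hy.1))).trans ?_
    rw [intervalIntegral.integral_interval_sub_left (hint _ _) (hint _ _)]
    refine intervalIntegral.norm_integral_le_of_norm_le_const (f := k) fun z hz => ?_
    have hz' : z ∈ Icc a b := by
      have := uIoc_subset_uIcc hz
      exact uIcc_subset_Icc hy hx this
    rw [Real.norm_of_nonneg (hk0 z (ha.trans hz'.1))]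
    exact hC z hz'
  have hderiv : ∀ᵐ r, deriv G r = -(k r * G r) := by
    filter_upwards [_root_.LocallyIntegrable.ae_hasDerivAt_integral hk] with r hr
    have := ((hr h).neg).exp
    rw [show deriv G r = _ from this.deriv]
    simp only [hG, Pi.neg_apply]
    ring
  have hmain := hlip.absolutelyContinuousOnInterval.integral_deriv_eq_sub
  rw [intervalIntegral.integral_congr_ae (g := fun r => -(k r * G r))
    (hderiv.mono fun r hr _ => hr), intervalIntegral.integral_neg] at hmain
  linarith

/-- The substitution `y = √(x² + h²)`, `y dy = x dx`, between horizontal and spatial distance. -/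
theorem integral_comp_sqrt_sq_sub_sq {h : ℝ} (hh : 0 < h) (f : ℝ → ℝ) {r : ℝ} (hr : h ≤ r) :
    ∫ x in h..r, x * f √(x ^ 2 - h ^ 2) = ∫ x in (0 : ℝ)..√(r ^ 2 - h ^ 2), x * f x := by
  set u := √(r ^ 2 - h ^ 2) with hu
  have hr0 : 0 < r := hh.trans_le hr
  have hu2 : u ^ 2 = r ^ 2 - h ^ 2 := Real.sq_sqrt (by nlinarith)
  have hu0 : 0 ≤ u := Real.sqrt_nonneg _
  have hq : ∀ x : ℝ, 0 < x ^ 2 + h ^ 2 := fun x => by positivity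
  have himg : (fun x => √(x ^ 2 + h ^ 2)) '' Ioo 0 u = Ioo h r := by
    ext y
    constructor
    · rintro ⟨x, ⟨hx0, hxu⟩, rfl⟩
      refine ⟨(Real.lt_sqrt hh.le).2 (by nlinarith), (Real.sqrt_lt' hr0).2 ?_⟩
      nlinarith
    · rintro ⟨h1, h2⟩
      have hy2 : √(y ^ 2 - h ^ 2) ^ 2 = y ^ 2 - h ^ 2 := Real.sq_sqrt (by nlinarith)
      refine ⟨√(y ^ 2 - h ^ 2), ⟨Real.sqrt_pos.2 (by nlinarith),
        Real.sqrt_lt_sqrt (by nlinarith) (by nlinarith)⟩, ?_⟩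
      simp only [hy2, sub_add_cancel]
      exact Real.sqrt_sq (by linarith)
  have hder : ∀ x ∈ Ioo 0 u, HasDerivWithinAt (fun x => √(x ^ 2 + h ^ 2)) (x / √(x ^ 2 + h ^ 2))
      (Ioo 0 u) x := fun x _ => by
    have h1 : HasDerivAt (fun x : ℝ => x ^ 2 + h ^ 2) (2 * x) x := by
      simpa using (hasDerivAt_pow 2 x).add_const (h ^ 2)
    have h2 := (h1.sqrt (hq x).ne').hasDerivWithinAt (s := Ioo 0 u)
    rwa [mul_div_mul_left _ _ two_ne_zero] at h2
  have hinj : InjOn (fun x => √(x ^ 2 + h ^ 2)) (Ioo 0 u) := fun x hx y hy hxy => by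
    have := (Real.sqrt_inj (hq x).le (hq y).le).1 hxy
    exact (sq_eq_sq₀ hx.1.le hy.1.le).1 (by linarith)
  have hcv := integral_image_eq_integral_abs_deriv_smul measurableSet_Ioo hder hinj
    (fun x => x * f √(x ^ 2 - h ^ 2))
  rw [himg] at hcv
  rw [intervalIntegral.integral_of_le hr, integral_Ioc_eq_integral_Ioo, hcv,
    intervalIntegral.integral_of_le hu0, integral_Ioc_eq_integral_Ioo]
  refine setIntegral_congr_fun measurableSet_Ioo fun x hx => ?_
  have hs : 0 < √(x ^ 2 + h ^ 2) := Real.sqrt_pos.2 (hq x)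
  simp only [smul_eq_mul]
  rw [Real.sq_sqrt (hq x).le, add_sub_cancel_right, Real.sqrt_sq hx.1.le,
    abs_of_nonneg (div_nonneg hx.1.le hs.le)]
  field_simp

/-- The probability that no ABS of link state `s` is (spatially) closer than `a`. -/
noncomputable def survival (p : Params) (PL : ℝ → ℝ) (s : LinkState) (a : ℝ) : ℝ :=
  Real.exp (-(2 * Real.pi * p.lamA * ∫ x in (0 : ℝ)..√(a ^ 2 - p.h ^ 2), x * linkProb PL s x))

theorem survival_pos (p : Params) (PL : ℝ → ℝ) (s : LinkState) (a : ℝ) : 0 < survival p PL s a :=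
  Real.exp_pos _

theorem fRN_eq (p : Params) (PL : ℝ → ℝ) (r : ℝ) :
    p.fRN PL r = 2 * Real.pi * p.lamA * (r * linkProb PL .nlos √(r ^ 2 - p.h ^ 2)) *
      survival p PL .nlos r := by
  simp only [Params.fRN, survival, linkProb]
  ring

theorem integrandN_eq (p : Params) (PL : ℝ → ℝ) (r : ℝ) :
    p.integrandN PL r = survival p PL .los (p.tauLN r) * p.fRN PL r := rfl

theorem locallyIntegrable_id_mul {q : ℝ → ℝ} (hq : Measurable q) (hb : ∀ x, |q x| ≤ 1) :
    LocallyIntegrable (fun x => x * q x) volume := by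
  have h1 : LocallyIntegrable (fun x : ℝ => x) volume := continuous_id.locallyIntegrable
  refine h1.mono (measurable_id.mul hq).aestronglyMeasurable (ae_of_all _ fun x => ?_)
  rw [norm_mul]
  exact mul_le_of_le_one_right (norm_nonneg _) (hb x)

theorem abs_linkProb_le_one {PL : ℝ → ℝ} (hPL : IsLoSProbability PL) (s : LinkState) {x : ℝ}
    (hx : 0 ≤ x) : |linkProb PL s x| ≤ 1 := by
  rw [abs_of_nonneg (linkProb_nonneg hPL s hx)]
  exact linkProb_le_one hPL s hx

theorem continuous_survival (p : Params) {PL : ℝ → ℝ} (hPL : IsLoSProbability PL)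
    (s : LinkState) : Continuous (survival p PL s) := by
  -- `PL` is bounded at nonnegative distances only; `|x|` gives a function on the whole line with
  -- the same integrals over `[0, u]`.
  have h1 : LocallyIntegrable (fun x => x * linkProb PL s |x|) volume :=
    locallyIntegrable_id_mul ((measurable_linkProb hPL s).comp measurable_abs)
      fun x => abs_linkProb_le_one hPL s (abs_nonneg x)
  have h2 : Continuous fun u => ∫ x in (0 : ℝ)..u, x * linkProb PL s |x| :=
    intervalIntegral.continuous_primitive (fun a b => intervalIntegrable_iff.2
      ((h1.integrableOn_isCompact isCompact_uIcc).mono_set uIoc_subset_uIcc)) 0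
  have h3 : survival p PL s = fun a => Real.exp (-(2 * Real.pi * p.lamA *
      (fun u => ∫ x in (0 : ℝ)..u, x * linkProb PL s |x|) √(a ^ 2 - p.h ^ 2))) := by
    funext a
    simp only [survival]
    congr 3
    refine intervalIntegral.integral_congr fun x hx => ?_
    rw [uIcc_of_le (Real.sqrt_nonneg _)] at hx
    simp only [abs_of_nonneg hx.1]
  rw [h3]
  fun_prop

theorem survival_of_le (p : Params) (PL : ℝ → ℝ) (s : LinkState) {a : ℝ} (ha : 0 ≤ a)
    (hah : a ≤ p.h) : survival p PL s a = 1 := by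
  have : √(a ^ 2 - p.h ^ 2) = 0 := Real.sqrt_eq_zero_of_nonpos (by nlinarith)
  simp [survival, this]

theorem measurable_fRN (p : Params) {PL : ℝ → ℝ} (hPL : IsLoSProbability PL) :
    Measurable (p.fRN PL) := by
  have h1 : p.fRN PL = fun r => 2 * Real.pi * p.lamA * (r * linkProb PL .nlos √(r ^ 2 - p.h ^ 2)) *
      survival p PL .nlos r := funext (fRN_eq p PL)
  have h2 := (continuous_survival p hPL .nlos).measurable
  have h3 := measurable_linkProb hPL .nlos
  rw [h1]
  fun_prop

theorem fRN_nonneg (p : Params) {PL : ℝ → ℝ} (hPL : IsLoSProbability PL) {r : ℝ} (hr : 0 ≤ r) :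
    0 ≤ p.fRN PL r := by
  rw [fRN_eq]
  have h1 := linkProb_nonneg hPL .nlos (Real.sqrt_nonneg (r ^ 2 - p.h ^ 2))
  have h2 := survival_pos p PL .nlos r
  have h3 := p.lamA_pos
  positivity

theorem measurable_integrandN (p : Params) {PL : ℝ → ℝ} (hPL : IsLoSProbability PL) :
    Measurable (p.integrandN PL) := by
  have h1 : p.integrandN PL = fun r => survival p PL .los (p.tauLN r) * p.fRN PL r := rfl
  have h2 := (continuous_survival p hPL .los).measurable
  have h3 := measurable_fRN p hPL
  have h4 : Measurable p.tauLN := by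
    unfold Params.tauLN
    fun_prop
  rw [h1]
  fun_prop

/-- In spatial distance the survival function is `exp (-∫ k)` with `k r = 2π λ_A r P_N(√(r² - h²))`,
and `fRN` is `k * exp (-∫ k)`. On `[a, b]` one has `k ≤ 2π λ_A b`. -/
theorem integral_fRN (p : Params) {PL : ℝ → ℝ} (hPL : IsLoSProbability PL) {a b : ℝ}
    (ha : p.h ≤ a) (hab : a ≤ b) :
    ∫ r in a..b, p.fRN PL r = survival p PL .nlos a - survival p PL .nlos b := by
  have hc : 0 ≤ 2 * Real.pi * p.lamA := by
    have := p.lamA_pos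
    positivity
  set q : ℝ → ℝ := fun r => linkProb PL .nlos √(r ^ 2 - p.h ^ 2) with hq
  have hq0 : ∀ r, 0 ≤ q r := fun r => linkProb_nonneg hPL _ (Real.sqrt_nonneg _)
  have hq1 : ∀ r, q r ≤ 1 := fun r => linkProb_le_one hPL _ (Real.sqrt_nonneg _)
  have hqm : Measurable q := by
    have h3 := measurable_linkProb hPL .nlos
    fun_prop
  have hk : LocallyIntegrable (fun r => 2 * Real.pi * p.lamA * (r * q r)) volume := by
    have := (locallyIntegrable_id_mul hqm fun x => by
      rw [abs_of_nonneg (hq0 x)]; exact hq1 x).smul (2 * Real.pi * p.lamA)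
    exact this
  have hsurv : ∀ r, p.h ≤ r → survival p PL .nlos r =
      Real.exp (-∫ x in p.h..r, 2 * Real.pi * p.lamA * (x * q x)) := fun r hr => by
    rw [survival, intervalIntegral.integral_const_mul, hq,
      integral_comp_sqrt_sq_sub_sq p.h_pos (linkProb PL .nlos) hr]
  rw [hsurv a ha, hsurv b (ha.trans hab), ← integral_mul_exp_neg_primitive hk ha hab
    (C := 2 * Real.pi * p.lamA * b)]
  · refine intervalIntegral.integral_congr fun r hr => ?_
    rw [uIcc_of_le hab] at hr
    rw [fRN_eq]
    rw [hsurv r (ha.trans hr.1)]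
  · intro r hr
    exact mul_nonneg hc (mul_nonneg (p.h_pos.le.trans hr) (hq0 r))
  · intro r hr
    have : 0 ≤ r := p.h_pos.le.trans (ha.trans hr.1)
    exact mul_le_mul_of_nonneg_left ((mul_le_of_le_one_right this (hq1 r)).trans hr.2) hc

theorem setLIntegral_fRN (p : Params) {PL : ℝ → ℝ} (hPL : IsLoSProbability PL) {a b : ℝ}
    (ha : p.h ≤ a) (hab : a ≤ b) :
    ∫⁻ r in Ico a b, ENNReal.ofReal (p.fRN PL r) =
      ENNReal.ofReal (survival p PL .nlos a - survival p PL .nlos b) := by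
  have hc : 0 ≤ 2 * Real.pi * p.lamA := by
    have := p.lamA_pos
    positivity
  rw [restrict_Ico_eq_restrict_Ioc, ← integral_fRN p hPL ha hab,
    intervalIntegral.integral_of_le hab, ofReal_integral_eq_lintegral_ofReal]
  · refine Measure.integrableOn_of_bounded (M := 2 * Real.pi * p.lamA * b) (by simp)
      (measurable_fRN p hPL).aestronglyMeasurable ?_
    filter_upwards [ae_restrict_mem measurableSet_Ioc] with r hr
    have hr0 : 0 ≤ r := p.h_pos.le.trans (ha.trans hr.1.le)
    rw [Real.norm_of_nonneg (fRN_nonneg p hPL hr0), fRN_eq]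
    have hq0 := linkProb_nonneg hPL .nlos (Real.sqrt_nonneg (r ^ 2 - p.h ^ 2))
    have hq1 := linkProb_le_one hPL .nlos (Real.sqrt_nonneg (r ^ 2 - p.h ^ 2))
    have hs : survival p PL .nlos r ≤ 1 := by
      rw [survival, Real.exp_le_one_iff, neg_nonpos]
      refine mul_nonneg hc (intervalIntegral.integral_nonneg (Real.sqrt_nonneg _) fun x hx => ?_)
      exact mul_nonneg hx.1 (linkProb_nonneg hPL _ hx.1)
    refine (mul_le_of_le_one_right (by positivity) hs).trans ?_
    exact mul_le_mul_of_nonneg_left ((mul_le_of_le_one_right hr0 hq1).trans hr.2) hc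
  · filter_upwards [ae_restrict_mem measurableSet_Ioc] with r hr
    exact fRN_nonneg p hPL (p.h_pos.le.trans (ha.trans hr.1.le))

/-! ### Joint law of the LoS and NLoS distances -/

section Law
variable {Ω : Type*} [MeasurableSpace Ω] {μ : Measure Ω} [IsProbabilityMeasure μ] {p : Params}
  {PL : ℝ → ℝ} {X : ℕ → Ω → Plane} {S : ℕ → Ω → LinkState}

theorem measureReal_ofReal_le_RA_and (hPL : IsLoSProbability PL) (hX : IsHPPP μ p.lamA X)
    (hS : IsLinkMarking μ PL X S) {a b : ℝ} (ha : 0 ≤ a) (hb : 0 ≤ b) :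
    μ.real {ω | ENNReal.ofReal a ≤ RA p.h X S .los ω ∧ ENNReal.ofReal b ≤ RA p.h X S .nlos ω} =
      survival p PL .los a * survival p PL .nlos b := by
  have h := hS.measureReal_forall_le_norm p.lamA_pos.le hPL hX
    (u := fun s => match s with
      | .los => √(a ^ 2 - p.h ^ 2)
      | .nlos => √(b ^ 2 - p.h ^ 2)) (fun s => by cases s <;> exact Real.sqrt_nonneg _)
  refine Eq.trans ?_ h
  congr 1
  ext ω
  simp only [mem_ofPred_eq, ofReal_le_RA_iff ha, ofReal_le_RA_iff hb, ← forall_and]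
  refine forall_congr' fun i => ?_
  cases S i ω <;> simp

theorem measureReal_ofReal_le_RA (hPL : IsLoSProbability PL) (hX : IsHPPP μ p.lamA X)
    (hS : IsLinkMarking μ PL X S) (s : LinkState) {a : ℝ} (ha : 0 ≤ a) :
    μ.real {ω | ENNReal.ofReal a ≤ RA p.h X S s ω} = survival p PL s a := by
  cases s
  -- At level `0` the condition on the other state is empty and its `survival` factor is `1`.
  · have := measureReal_ofReal_le_RA_and hPL hX hS ha le_rfl
    simpa [survival_of_le p PL _ le_rfl p.h_pos.le] using this
  · have := measureReal_ofReal_le_RA_and hPL hX hS le_rfl ha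
    simpa [survival_of_le p PL _ le_rfl p.h_pos.le] using this

theorem indepFun_RA (hPL : IsLoSProbability PL) (hX : IsHPPP μ p.lamA X)
    (hS : IsLinkMarking μ PL X S) : IndepFun (RA p.h X S .los) (RA p.h X S .nlos) μ := by
  refine indepFun_of_measure_ofReal_le (measurable_RA _ hX.measurable hS.measurable _)
    (measurable_RA _ hX.measurable hS.measurable _) fun a b ha hb => ?_
  rw [measureReal_ofReal_le_RA_and hPL hX hS ha hb, measureReal_ofReal_le_RA hPL hX hS _ ha,
    measureReal_ofReal_le_RA hPL hX hS _ hb]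

theorem measure_RA_eq_ofReal (hPL : IsLoSProbability PL) (hX : IsHPPP μ p.lamA X)
    (hS : IsLinkMarking μ PL X S) (s : LinkState) {a : ℝ} (ha : 0 ≤ a) :
    μ {ω | RA p.h X S s ω = ENNReal.ofReal a} = 0 :=
  measure_eq_ofReal_eq_zero (measurable_RA _ hX.measurable hS.measurable _)
    (continuous_survival p hPL s) (fun _ hb => measureReal_ofReal_le_RA hPL hX hS s hb) ha

/-- `f_{R_{N,0}}` is the density of the distance to the nearest NLoS ABS where it is finite. -/
theorem map_toReal_RA_nlos (hPL : IsLoSProbability PL) (hX : IsHPPP μ p.lamA X)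
    (hS : IsLinkMarking μ PL X S) :
    (μ.restrict {ω | RA p.h X S .nlos ω ≠ ⊤}).map (fun ω => (RA p.h X S .nlos ω).toReal) =
      (volume.restrict (Ici p.h)).withDensity fun r => ENNReal.ofReal (p.fRN PL r) := by
  have hm := measurable_RA p.h hX.measurable hS.measurable .nlos
  refine Measure.ext_of_Ico' _ _ (fun a b _ => measure_ne_top _ _) fun a b hab => ?_
  rw [Measure.map_apply hm.ennreal_toReal measurableSet_Ico,
    Measure.restrict_apply (hm.ennreal_toReal measurableSet_Ico),
    withDensity_apply _ measurableSet_Ico, Measure.restrict_restrict measurableSet_Ico]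
  have e1 : Ico a b ∩ Ici p.h = Ico (max a p.h) (max b p.h) := by
    ext x
    simp only [mem_inter_iff, mem_Ico, mem_Ici, max_le_iff, lt_max_iff]
    constructor
    · rintro ⟨⟨h1, h2⟩, h3⟩
      exact ⟨⟨h1, h3⟩, Or.inl h2⟩
    · rintro ⟨⟨h1, h3⟩, h2 | h2⟩
      · exact ⟨⟨h1, h2⟩, h3⟩
      · exact absurd h3 (not_le.2 h2)
  -- No ABS is closer than `h`, so clipping at `h` or at `0` gives the same survival.
  have e2 : ∀ c, survival p PL .nlos (max c p.h) = survival p PL .nlos (max c 0) := fun c => by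
    rcases le_total c p.h with hc | hc
    · rw [max_eq_right hc, survival_of_le p PL _ p.h_pos.le le_rfl,
        survival_of_le p PL _ (le_max_right _ _) (max_le hc p.h_pos.le)]
    · rw [max_eq_left hc, max_eq_left (p.h_pos.le.trans hc)]
  -- `toReal` sends `∞` to `0`, hence the restriction to finite distances; the difference of tail
  -- events discards `∞` by itself.
  have e3 : (fun ω => (RA p.h X S .nlos ω).toReal) ⁻¹' Ico a b ∩ {ω | RA p.h X S .nlos ω ≠ ⊤} =
      {ω | ENNReal.ofReal (max a 0) ≤ RA p.h X S .nlos ω} \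
        {ω | ENNReal.ofReal (max b 0) ≤ RA p.h X S .nlos ω} := by
    ext ω
    simp only [mem_inter_iff, mem_preimage, mem_Ico, mem_ofPred_eq, Set.mem_sdiff, not_le]
    constructor
    · rintro ⟨⟨h1, h2⟩, h3⟩
      rw [← ENNReal.ofReal_toReal h3]
      refine ⟨ENNReal.ofReal_le_ofReal (max_le h1 ENNReal.toReal_nonneg), ?_⟩
      exact (ENNReal.ofReal_lt_ofReal_iff_of_nonneg ENNReal.toReal_nonneg).2
        (h2.trans_le (le_max_left _ _))
    · rintro ⟨h1, h2⟩
      have h3 : RA p.h X S .nlos ω ≠ ⊤ := h2.ne_top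
      rw [← ENNReal.ofReal_toReal h3] at h1 h2
      rw [ENNReal.ofReal_le_ofReal_iff ENNReal.toReal_nonneg] at h1
      rw [ENNReal.ofReal_lt_ofReal_iff_of_nonneg ENNReal.toReal_nonneg] at h2
      refine ⟨⟨(le_max_left _ _).trans h1, ?_⟩, h3⟩
      rcases lt_max_iff.1 h2 with h | h
      · exact h
      · exact absurd h (not_lt.2 ENNReal.toReal_nonneg)
  rw [e1, setLIntegral_fRN p hPL (le_max_right _ _) (max_le_max_right _ hab.le), e2, e2, e3,
    ← ofReal_measureReal, measureReal_sdiff,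
    measureReal_ofReal_le_RA hPL hX hS _ (le_max_right _ _),
    measureReal_ofReal_le_RA hPL hX hS _ (le_max_right _ _)]
  · exact fun ω hω => (ENNReal.ofReal_le_ofReal (max_le_max_right _ hab.le)).trans hω
  · exact measurableSet_le measurable_const hm

end Law

/-! ### Power thresholds and the TBS process -/

theorem Params.etaT_pos (p : Params) : 0 < p.etaT := mul_pos (mul_pos p.GM_pos p.PT_pos) p.CT_pos
theorem Params.etaL_pos (p : Params) : 0 < p.etaL := mul_pos (mul_pos p.an_pos p.PA_pos) p.CL_pos
theorem Params.etaN_pos (p : Params) : 0 < p.etaN := mul_pos (mul_pos p.an_pos p.PA_pos) p.CN_pos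

theorem tauLN_pos (p : Params) {r : ℝ} (hr : 0 < r) : 0 < p.tauLN r := by
  have h1 := p.etaL_pos
  have h2 := p.etaN_pos
  unfold Params.tauLN
  positivity

/-- A LoS ABS at distance `τ_{L|N}(r)` and a NLoS ABS at distance `r` have the same power. -/
theorem etaL_mul_tauLN_rpow (p : Params) {r : ℝ} (hr : 0 < r) :
    ENNReal.ofReal p.etaL * ENNReal.ofReal (p.tauLN r) ^ (-p.alphaL) =
      ENNReal.ofReal p.etaN * ENNReal.ofReal r ^ (-p.alphaN) := by
  have h1 := p.etaL_pos
  have h2 := p.etaN_pos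
  have h3 := p.alphaL_pos.ne'
  rw [ENNReal.ofReal_rpow_of_pos (tauLN_pos p hr), ENNReal.ofReal_rpow_of_pos hr,
    ← ENNReal.ofReal_mul h1.le, ← ENNReal.ofReal_mul h2.le]
  congr 1
  rw [Params.tauLN, Real.mul_rpow (by positivity) (by positivity), ← Real.rpow_mul (by positivity),
    ← Real.rpow_mul hr.le, show 1 / p.alphaL * -p.alphaL = -1 by field_simp,
    show p.alphaN / p.alphaL * -p.alphaL = -p.alphaN by field_simp, Real.rpow_neg_one]
  field_simp

theorem measureReal_compl_tbsInBall {Ω : Type*} [MeasurableSpace Ω] {μ : Measure Ω} {p : Params}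
    {Y : ℕ → Ω → Plane} (hY : IsHPPP μ p.lamT Y) :
    μ.real (tbsInBall p Y)ᶜ = 1 - p.QT := by
  have h := hY.measureReal_forall_notMem p.lamT_pos.le (B := Metric.closedBall 0 p.RB)
    Metric.isClosed_closedBall.measurableSet Metric.isBounded_closedBall
  have e : (tbsInBall p Y)ᶜ = {ω | ∀ i, Y i ω ∉ Metric.closedBall 0 p.RB} := by
    ext ω
    simp [tbsInBall]
  rw [e, h, Params.QT, sub_sub_cancel]
  congr 2
  simp [measureReal_def, Real.pi_pos.le, ENNReal.toReal_ofReal p.RB_pos.le]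
  ring

/-- Applied to coordinate sequences, the definitions exhibit both distances as measurable functions
of the two independent families. -/
theorem indepFun_RA_RT {Ω : Type*} [MeasurableSpace Ω] {μ : Measure Ω} {p : Params}
    {Y X : ℕ → Ω → Plane} {S : ℕ → Ω → LinkState} (hYXS : IndepFun (fun ω i => Y i ω)
    (fun ω => (fun i => X i ω, fun i => S i ω)) μ) (s : LinkState) :
    IndepFun (RA p.h X S s) (RT Y) μ := by
  have h1 : Measurable (RA p.h (fun i (q : (ℕ → Plane) × (ℕ → LinkState)) => q.1 i)
      (fun i q => q.2 i) s) :=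
    measurable_RA _ (fun i => (measurable_pi_apply i).comp measurable_fst)
      (fun i => (measurable_pi_apply i).comp measurable_snd) s
  have h2 : Measurable (RT fun i (y : ℕ → Plane) => y i) := measurable_RT measurable_pi_apply
  exact hYXS.symm.comp h1 h2

theorem disjoint_assoc {Ω : Type*} {p : Params} {Y X : ℕ → Ω → Plane}
    {S : ℕ → Ω → LinkState} {t t' : Tier} (h : t ≠ t') :
    Disjoint (assoc p Y X S t) (assoc p Y X S t') :=
  Set.disjoint_left.2 fun _ h1 h2 => lt_asymm (h1 t' h.symm) (h2 t h)

/-! ### Comparison of powers and association probabilities -/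

section Main
variable {Ω : Type*} [MeasurableSpace Ω] {μ : Measure Ω} [IsProbabilityMeasure μ] {p : Params}
  {PL : ℝ → ℝ} {Y X : ℕ → Ω → Plane} {S : ℕ → Ω → LinkState}

/-- Lower power means larger distance, so the event is `τ_{L|N}(r) < R_{L,0}`. The survival function
has `≤` instead, which differs by a null atom. -/
theorem measure_power_los_lt_const (hPL : IsLoSProbability PL) (hX : IsHPPP μ p.lamA X)
    (hS : IsLinkMarking μ PL X S) {r : ℝ} (hr : 0 < r) :
    μ {ω | ENNReal.ofReal p.etaL * RA p.h X S .los ω ^ (-p.alphaL) <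
        ENNReal.ofReal p.etaN * ENNReal.ofReal r ^ (-p.alphaN)} =
      ENNReal.ofReal (survival p PL .los (p.tauLN r)) := by
  have ht := (tauLN_pos p hr).le
  simp_rw [← etaL_mul_tauLN_rpow p hr]
  simp_rw [(strictAnti_ofReal_mul_rpow p.etaL_pos p.alphaL_pos).lt_iff_gt]
  rw [← measureReal_ofReal_le_RA hPL hX hS .los ht, ofReal_measureReal]
  refine measure_congr ?_
  have h0 : ∀ᵐ ω ∂μ, RA p.h X S .los ω ≠ ENNReal.ofReal (p.tauLN r) := by
    rw [ae_iff]
    simpa using measure_RA_eq_ofReal hPL hX hS .los ht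
  filter_upwards [h0] with ω hω
  exact propext ⟨fun h => le_of_lt h, fun h => lt_of_le_of_ne h hω.symm⟩

theorem measure_power_los_lt_power_nlos (hPL : IsLoSProbability PL) (hX : IsHPPP μ p.lamA X)
    (hS : IsLinkMarking μ PL X S) :
    μ {ω | power p Y X S .los ω < power p Y X S .nlos ω} =
      ∫⁻ r in Ici p.h, ENNReal.ofReal (p.integrandN PL r) := by
  have hL := measurable_RA p.h hX.measurable hS.measurable .los
  have hN := measurable_RA p.h hX.measurable hS.measurable .nlos
  let D : Set (ℝ≥0∞ × ℝ≥0∞) := {q | ENNReal.ofReal p.etaL * q.1 ^ (-p.alphaL) <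
    ENNReal.ofReal p.etaN * q.2 ^ (-p.alphaN)}
  have hD : MeasurableSet D := measurableSet_lt (by fun_prop) (by fun_prop)
  -- `Φ n` is the probability that the LoS power is below that of a NLoS ABS at distance `n`.
  let Φ : ℝ≥0∞ → ℝ≥0∞ := fun n => μ.map (RA p.h X S .los) ((fun l => (l, n)) ⁻¹' D)
  have hΦ : Measurable Φ := measurable_measure_prodMk_right hD
  have hΦeq : ∀ n, Φ n = μ {ω | ENNReal.ofReal p.etaL * RA p.h X S .los ω ^ (-p.alphaL) <
      ENNReal.ofReal p.etaN * n ^ (-p.alphaN)} := fun n =>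
    Measure.map_apply hL (measurable_prodMk_right hD)
  -- The power `0` of a missing NLoS ABS beats nothing, so a possible atom of `R_{N,0}` at `∞` drops
  -- out and the density carries the whole integral.
  have hΦtop : Φ ⊤ = 0 := by
    rw [hΦeq, ENNReal.top_rpow_of_neg (neg_neg_of_pos p.alphaN_pos)]
    simp
  have hfin : MeasurableSet {ω | RA p.h X S .nlos ω ≠ ⊤} := hN (measurableSet_singleton ⊤).compl
  calc μ {ω | power p Y X S .los ω < power p Y X S .nlos ω}
      = μ.map (fun ω => (RA p.h X S .los ω, RA p.h X S .nlos ω)) D :=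
        (Measure.map_apply (hL.prodMk hN) hD).symm
    _ = ∫⁻ n, Φ n ∂(μ.map (RA p.h X S .nlos)) := by
        rw [(indepFun_iff_map_prod_eq_prod_map_map hL.aemeasurable hN.aemeasurable).1
          (indepFun_RA hPL hX hS), Measure.prod_apply_symm hD]
    _ = ∫⁻ ω, Φ (RA p.h X S .nlos ω) ∂μ := lintegral_map hΦ hN
    _ = ∫⁻ ω in {ω | RA p.h X S .nlos ω ≠ ⊤}, Φ (RA p.h X S .nlos ω) ∂μ := by
        rw [← lintegral_indicator hfin]
        refine lintegral_congr fun ω => ?_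
        by_cases h : RA p.h X S .nlos ω = ⊤
        · simp [indicator, h, hΦtop]
        · simp [indicator, h]
    _ = ∫⁻ ω in {ω | RA p.h X S .nlos ω ≠ ⊤},
          Φ (ENNReal.ofReal (RA p.h X S .nlos ω).toReal) ∂μ :=
        setLIntegral_congr_fun hfin fun ω hω => by
          rw [ENNReal.ofReal_toReal hω]
    _ = ∫⁻ r, Φ (ENNReal.ofReal r) ∂((volume.restrict (Ici p.h)).withDensity
          fun r => ENNReal.ofReal (p.fRN PL r)) := by
        rw [← map_toReal_RA_nlos hPL hX hS]
        exact (lintegral_map (hΦ.comp ENNReal.measurable_ofReal) hN.ennreal_toReal).symm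
    _ = ∫⁻ r in Ici p.h, ENNReal.ofReal (p.fRN PL r) * Φ (ENNReal.ofReal r) :=
        lintegral_withDensity_eq_lintegral_mul _ (measurable_fRN p hPL).ennreal_ofReal
          (hΦ.comp ENNReal.measurable_ofReal)
    _ = ∫⁻ r in Ici p.h, ENNReal.ofReal (p.integrandN PL r) :=
        setLIntegral_congr_fun measurableSet_Ici fun r hr => by
          rw [hΦeq, measure_power_los_lt_const hPL hX hS (p.h_pos.trans_le hr), integrandN_eq,
            ENNReal.ofReal_mul (survival_pos p PL _ _).le, mul_comm]

theorem integrandN_nonneg (hPL : IsLoSProbability PL) {r : ℝ} (hr : r ∈ Ici p.h) :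
    0 ≤ p.integrandN PL r :=
  mul_nonneg (Real.exp_pos _).le (fRN_nonneg p hPL (p.h_pos.le.trans hr))

theorem integrableOn_integrandN (hPL : IsLoSProbability PL) (hX : IsHPPP μ p.lamA X)
    (hS : IsLinkMarking μ PL X S) : IntegrableOn (p.integrandN PL) (Ici p.h) := by
  refine ⟨(measurable_integrandN p hPL).aestronglyMeasurable, ?_⟩
  -- The integral is a probability, hence finite. LoS and NLoS powers ignore the TBSs, so `X` may
  -- stand in for `Y`.
  rw [hasFiniteIntegral_iff_ofReal, ← measure_power_los_lt_power_nlos (Y := X) hPL hX hS]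
  · exact measure_lt_top _ _
  · filter_upwards [ae_restrict_mem measurableSet_Ici] with r hr
    exact integrandN_nonneg hPL hr

theorem measureReal_power_los_lt_power_nlos (hPL : IsLoSProbability PL) (hX : IsHPPP μ p.lamA X)
    (hS : IsLinkMarking μ PL X S) :
    μ.real {ω | power p Y X S .los ω < power p Y X S .nlos ω} =
      ∫ r in Ici p.h, p.integrandN PL r := by
  rw [measureReal_def, measure_power_los_lt_power_nlos hPL hX hS,
    integral_eq_lintegral_of_nonneg_ae _ (measurable_integrandN p hPL).aestronglyMeasurable]
  filter_upwards [ae_restrict_mem measurableSet_Ici] with r hr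
  exact integrandN_nonneg hPL hr

theorem measure_RT_eq_ofReal (hY : IsHPPP μ p.lamT Y) {a : ℝ} (ha : 0 ≤ a) :
    μ {ω | RT Y ω = ENNReal.ofReal a} = 0 :=
  measure_eq_ofReal_eq_zero (measurable_RT hY.measurable)
    (G := fun a => Real.exp (-(Real.pi * p.lamT * a ^ 2))) (by fun_prop)
    (fun _ hb => hY.measureReal_ofReal_le_RT p.lamT_pos.le hb) ha

/-- Almost surely the powers of the LoS and NLoS ABSs do not tie. -/
theorem ae_power_los_ne_nlos (hPL : IsLoSProbability PL) (hX : IsHPPP μ p.lamA X)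
    (hS : IsLinkMarking μ PL X S) :
    ∀ᵐ ω ∂μ, power p Y X S .los ω ≠ power p Y X S .nlos ω := by
  have h := measure_tie_eq_zero (measurable_RA p.h hX.measurable hS.measurable .los)
    (measurable_RA p.h hX.measurable hS.measurable .nlos) (indepFun_RA hPL hX hS)
    (fun a ha => measure_RA_eq_ofReal hPL hX hS .nlos ha)
    (f := fun x => ENNReal.ofReal p.etaL * x ^ (-p.alphaL)) (by fun_prop) (by fun_prop)
    (strictAnti_ofReal_mul_rpow p.etaN_pos p.alphaN_pos).injective
  filter_upwards [measure_eq_zero_iff_ae_notMem.1 h] with ω hω heq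
  -- A tie with `R_{N,0} = ∞` would force `R_{L,0} = ∞` as well.
  refine hω ⟨heq, fun htop => ?_⟩
  have htop' : RA p.h X S .los ω = ⊤ := by
    simp only [power, htop, ENNReal.top_rpow_of_neg (neg_neg_of_pos p.alphaN_pos), mul_zero,
      mul_eq_zero, ENNReal.ofReal_eq_zero, not_le.2 p.etaL_pos, false_or,
      ENNReal.rpow_eq_zero_iff, neg_pos, not_lt.2 p.alphaL_pos.le, and_false] at heq
    exact heq.1
  have h0 := RA_ne_top (h := p.h) (X := X) (S := S) ω
  cases hs : S 0 ω <;> rw [hs] at h0 <;> contradiction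

/-- Almost surely the power of the TBSs does not tie with that of the ABSs of state `s`, unless
both vanish. -/
theorem ae_power_tbs_tie {f : ℝ≥0∞ → ℝ≥0∞} (hf : Measurable f) (hY : IsHPPP μ p.lamT Y)
    (hX : IsHPPP μ p.lamA X) (hS : IsLinkMarking μ PL X S)
    (hYXS : IndepFun (fun ω i => Y i ω) (fun ω => (fun i => X i ω, fun i => S i ω)) μ)
    (s : LinkState) :
    ∀ᵐ ω ∂μ, power p Y X S .tbs ω = f (RA p.h X S s ω) → power p Y X S .tbs ω = 0 := by
  have h := measure_tie_eq_zero (measurable_RA p.h hX.measurable hS.measurable s)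
    (measurable_RT hY.measurable) (indepFun_RA_RT hYXS s) (fun a ha => measure_RT_eq_ofReal hY ha)
    (g := fun x => ENNReal.ofReal p.etaT * x ^ (-p.alphaT)) hf (by fun_prop)
    (strictAnti_ofReal_mul_rpow p.etaT_pos p.alphaT_pos).injective
  filter_upwards [measure_eq_zero_iff_ae_notMem.1 h] with ω hω heq
  simp only [power] at heq ⊢
  split_ifs at heq ⊢
  · exact absurd ⟨heq.symm, RT_ne_top ω⟩ hω
  · rfl

theorem measurable_power (hY : ∀ i, Measurable (Y i)) (hX : ∀ i, Measurable (X i))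
    (hS : ∀ i, Measurable (S i)) (t : Tier) : Measurable (power p Y X S t) := by
  have h1 := measurable_RT hY
  have h2 := measurable_RA p.h hX hS
  cases t
  · exact Measurable.ite (measurableSet_le h1 measurable_const)
      ((h1.pow_const _).const_mul _) measurable_const
  · exact ((h2 .los).pow_const _).const_mul _
  · exact ((h2 .nlos).pow_const _).const_mul _

theorem measurableSet_assoc (hY : ∀ i, Measurable (Y i)) (hX : ∀ i, Measurable (X i))
    (hS : ∀ i, Measurable (S i)) (t : Tier) : MeasurableSet (assoc p Y X S t) := by
  have hm := measurable_power (p := p) hY hX hS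
  have : assoc p Y X S t = ⋂ (t' : Tier) (_ : t' ≠ t),
      {ω | power p Y X S t' ω < power p Y X S t ω} := by
    ext ω
    simp [assoc]
  have hc : Countable Tier := by
    have : Finite Tier := .of_surjective (fun i : Fin 3 =>
      match i with
      | 0 => Tier.tbs
      | 1 => Tier.los
      | 2 => Tier.nlos) fun t => by
        cases t
        exacts [⟨0, rfl⟩, ⟨1, rfl⟩, ⟨2, rfl⟩]
    infer_instance
  rw [this]
  exact MeasurableSet.iInter fun t' => MeasurableSet.iInter fun _ => measurableSet_lt (hm t') (hm t)

/-- Almost surely the LoS and NLoS powers differ, so the larger of them is positive, and the TBS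
power cannot tie with it since such a tie happens only at `0`. -/
theorem ae_mem_assoc (hPL : IsLoSProbability PL) (hY : IsHPPP μ p.lamT Y)
    (hX : IsHPPP μ p.lamA X) (hS : IsLinkMarking μ PL X S)
    (hYXS : IndepFun (fun ω i => Y i ω) (fun ω => (fun i => X i ω, fun i => S i ω)) μ) :
    ∀ᵐ ω ∂μ, ω ∈ assoc p Y X S .tbs ∪ assoc p Y X S .nlos ∪ assoc p Y X S .los := by
  filter_upwards [ae_power_los_ne_nlos (Y := Y) hPL hX hS,
    ae_power_tbs_tie (f := fun x => ENNReal.ofReal p.etaL * x ^ (-p.alphaL)) (by fun_prop)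
      hY hX hS hYXS .los,
    ae_power_tbs_tie (f := fun x => ENNReal.ofReal p.etaN * x ^ (-p.alphaN)) (by fun_prop)
      hY hX hS hYXS .nlos] with ω h1 h2 h3
  change power p Y X S .tbs ω = power p Y X S .los ω → _ at h2
  change power p Y X S .tbs ω = power p Y X S .nlos ω → _ at h3
  have hmem : ∀ t, ω ∈ assoc p Y X S t ↔
      ∀ t' : Tier, t' ≠ t → power p Y X S t' ω < power p Y X S t ω := fun _ => Iff.rfl
  have hall : ∀ P : Tier → Prop, (∀ t, P t) ↔ P .tbs ∧ P .los ∧ P .nlos := fun P =>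
    ⟨fun h => ⟨h _, h _, h _⟩, fun h t => by cases t; exacts [h.1, h.2.1, h.2.2]⟩
  simp only [mem_union, hmem, hall, ne_eq, not_true_eq_false, reduceCtorEq, not_false_eq_true,
    false_imp_iff, true_imp_iff, true_and, and_true]
  generalize power p Y X S .tbs ω = a at *
  generalize power p Y X S .los ω = b at *
  generalize power p Y X S .nlos ω = c at *
  rcases lt_or_gt_of_ne h1 with hbc | hbc
  · rcases lt_trichotomy a c with hac | hac | hac
    · exact Or.inl (Or.inr ⟨hac, hbc⟩)
    · rw [← hac, h3 hac] at hbc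
      exact absurd hbc not_lt_zero
    · exact Or.inl (Or.inl ⟨hbc.trans hac, hac⟩)
  · rcases lt_trichotomy a b with hab | hab | hab
    · exact Or.inr ⟨hab, hbc⟩
    · rw [← hab, h2 hab] at hbc
      exact absurd hbc not_lt_zero
    · exact Or.inl (Or.inl ⟨hab, hbc.trans hab⟩)

theorem measureReal_assoc_nlos_diff_tbsInBall (hPL : IsLoSProbability PL)
    (hY : IsHPPP μ p.lamT Y) (hX : IsHPPP μ p.lamA X) (hS : IsLinkMarking μ PL X S)
    (hYXS : IndepFun (fun ω i => Y i ω) (fun ω => (fun i => X i ω, fun i => S i ω)) μ) :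
    μ.real (assoc p Y X S .nlos \ tbsInBall p Y) =
      (1 - p.QT) * ∫ r in Ici p.h, p.integrandN PL r := by
  have hae : (assoc p Y X S .nlos \ tbsInBall p Y : Set Ω) =ᵐ[μ]
      ((tbsInBall p Y)ᶜ ∩ {ω | power p Y X S .los ω < power p Y X S .nlos ω} : Set Ω) := by
    -- `RT` is an infimum, so an empty closed disc gives only `R_B ≤ RT`; the null event `RT = R_B`
    -- is removed to make the TBS power vanish.
    filter_upwards [measure_eq_zero_iff_ae_notMem.1 (measure_RT_eq_ofReal hY p.RB_pos.le)] with ω hω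
    refine propext ⟨fun ⟨h1, h2⟩ => ⟨h2, h1 .los (by simp)⟩, fun ⟨h1, h2⟩ => ⟨fun t ht => ?_, h1⟩⟩
    have h1' : ENNReal.ofReal p.RB ≤ RT Y ω := by
      rw [ofReal_le_RT_iff]
      intro i
      by_contra hi
      exact h1 ⟨i, by simpa using (not_le.1 hi).le⟩
    cases t
    · have : power p Y X S .tbs ω = 0 :=
        if_neg (not_le.2 (lt_of_le_of_ne h1' (Ne.symm hω)))
      rw [this]
      exact bot_le.trans_lt h2
    · exact h2
    · exact absurd rfl ht
  rw [measureReal_congr hae, ← measureReal_compl_tbsInBall hY,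
    ← measureReal_power_los_lt_power_nlos (Y := Y) hPL hX hS]
  let A : Set (ℕ → Plane) := {y | ∃ i, y i ∈ Metric.closedBall (0 : Plane) p.RB}
  have hA : MeasurableSet A := by
    simp only [A, ofPred_exists]
    exact MeasurableSet.iUnion fun i =>
      measurable_pi_apply i Metric.isClosed_closedBall.measurableSet
  -- The comparison as an event of the ABS data alone; `q.1` fills the TBS slot, on which these two
  -- powers do not depend.
  let B : Set ((ℕ → Plane) × (ℕ → LinkState)) :=
    {q | power p (fun i q => q.1 i) (fun i q => q.1 i) (fun i q => q.2 i) .los q <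
      power p (fun i q => q.1 i) (fun i q => q.1 i) (fun i q => q.2 i) .nlos q}
  have hB : MeasurableSet B := by
    have h1 : ∀ i, Measurable fun q : (ℕ → Plane) × (ℕ → LinkState) => q.1 i :=
      fun i => (measurable_pi_apply i).comp measurable_fst
    have h2 : ∀ i, Measurable fun q : (ℕ → Plane) × (ℕ → LinkState) => q.2 i :=
      fun i => (measurable_pi_apply i).comp measurable_snd
    exact measurableSet_lt (measurable_power h1 h1 h2 _) (measurable_power h1 h1 h2 _)
  have hind := hYXS.measure_inter_preimage_eq_mul _ _ hA.compl hB
  rw [measureReal_def, measureReal_def, measureReal_def, ← ENNReal.toReal_mul]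
  exact congrArg ENNReal.toReal hind

end Main
end UAVHetNet

theorem mainTheorem2 {Ω : Type*} [MeasurableSpace Ω] (μ : Measure Ω) [IsProbabilityMeasure μ]
    (p : UAVHetNet.Params) (PL : ℝ → ℝ) (hPL : UAVHetNet.IsLoSProbability PL)
    (Y X : ℕ → Ω → UAVHetNet.Plane) (S : ℕ → Ω → UAVHetNet.LinkState)
    (hY : UAVHetNet.IsHPPP μ p.lamT Y)
    (hX : UAVHetNet.IsHPPP μ p.lamA X)
    (hS : UAVHetNet.IsLinkMarking μ PL X S)
    (hYXS : IndepFun (fun ω i => Y i ω) (fun ω => (fun i => X i ω, fun i => S i ω)) μ) :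
    IntegrableOn (p.integrandN PL) (Set.Ici p.h) ∧
    μ.real (UAVHetNet.assoc p Y X S UAVHetNet.Tier.nlos \ UAVHetNet.tbsInBall p Y) =
      (1 - p.QT) * ∫ r in Set.Ici p.h, p.integrandN PL r ∧
    ((∀ᵐ ω ∂μ, ω ∈ UAVHetNet.tbsInBall p Y →
        ω ∉ UAVHetNet.assoc p Y X S UAVHetNet.Tier.nlos) →
      μ.real (UAVHetNet.assoc p Y X S UAVHetNet.Tier.nlos) =
        (1 - p.QT) * ∫ r in Set.Ici p.h, p.integrandN PL r) ∧
    μ.real (UAVHetNet.assoc p Y X S UAVHetNet.Tier.tbs) =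
      1 - μ.real (UAVHetNet.assoc p Y X S UAVHetNet.Tier.nlos) -
        μ.real (UAVHetNet.assoc p Y X S UAVHetNet.Tier.los) := by
  have hdiff := UAVHetNet.measureReal_assoc_nlos_diff_tbsInBall hPL hY hX hS hYXS
  have hm := UAVHetNet.measurableSet_assoc (p := p) hY.measurable hX.measurable hS.measurable
  refine ⟨UAVHetNet.integrableOn_integrandN hPL hX hS, hdiff, fun hae => ?_, ?_⟩
  · rw [← hdiff]
    refine measureReal_congr ?_
    filter_upwards [hae] with ω hω
    exact propext ⟨fun h => ⟨h, fun h' => hω h' h⟩, fun h => h.1⟩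
  · have hunion := UAVHetNet.ae_mem_assoc hPL hY hX hS hYXS
    have h1 : μ.real (UAVHetNet.assoc p Y X S .tbs ∪ UAVHetNet.assoc p Y X S .nlos ∪
        UAVHetNet.assoc p Y X S .los) = 1 :=
      (measureReal_congr (Filter.eventuallyEq_univ.2 hunion)).trans probReal_univ
    rw [measureReal_union (Set.disjoint_union_left.2 ⟨UAVHetNet.disjoint_assoc (by simp),
        UAVHetNet.disjoint_assoc (by simp)⟩) (hm _),
      measureReal_union (UAVHetNet.disjoint_assoc (by simp)) (hm _)] at h1
    linarith
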